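/- **Theorem 1 (Asymptotic bias and variance).** Let $r\ge 1$ and $\boldsymbol d=(d_1,\dots,d_r)$ with integers $d_j\ge 1$. Let $\mathbb S^{\boldsymbol d}=\mathbb S^{d_1}\times\cdots\times\mathbb S^{d_r}$, where $\mathbb S^{d_j}\subset\mathbb R^{d_j+1}$ is the unit sphere. Let $\sigma_{d}$ be the surface area measure on $\mathbb S^{d}$, $\sigma_{\boldsymbol d}=\sigma_{d_1}\times\cdots\times\sigma_{d_r}$, $\omega_{d}=\sigma_{d}(\mathbb S^{d})$ and $\omega_{\boldsymbol d-1}=\prod_{j=1}^r\omega_{d_j-1}$. Let $f$ be a probability density on $\mathbb S^{\boldsymbol d}$ with respect to $\sigma_{\boldsymbol d}$, and let $X_1,X_2,\dots$ be i.i.d. with density $f$. For $\boldsymbol h=(h_1,\dots,h_r)$ with all $h_j>0$ put $\rho(\boldsymbol h)=\prod_{j=1}^r h_j^{d_j}$ and $$\hat f(x;\boldsymbol h)=\frac1n\sum_{i=1}^n c(\boldsymbol h)\,L\Big(\frac{1-x_1'X_{i,1}}{h_1^2},\dots,\frac{1-x_r'X_{i,r}}{h_r^2}\Big),\qquad c(\boldsymbol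 h)^{-1}=\int_{\mathbb S^{\boldsymbol d}}L\Big(\frac{1-x_1'y_1}{h_1^2},\dots,\frac{1-x_r'y_r}{h_r^2}\Big)\,\sigma_{\boldsymbol d}(\mathrm dx),$$ the last integral being independent of $y\in\mathbb S^{\boldsymbol d}$. Assume: * **A1.** The radial extension $\bar f(x)=f(x_1/\|x_1\|,\dots,x_r/\|x_r\|)$, defined for $x\in\prod_{j=1}^r(\mathbb R^{d_j+1}\setminus\{0\})$, is twice continuously differentiable on (a neighbourhood of) $\mathbb S^{\boldsymbol d}$. * **A2.** $L:\mathbb R_{\ge0}^r\to\mathbb R_{\ge0}$ is bounded and measurable, and for $\ell=1,2$ and all integers $m_1,\dots,m_r\ge1$, $\;0<\int_{\mathbb R_+^r}L(s)^\ell\prod_{j=1}^r s_j^{m_j/2-1}\,\mathrm ds<\infty$. * **A3.** $\boldsymbol h_n=(h_{1,n},\dots,h_{r,n})$ is a sequence of vectors with positive entries such that $\boldsymbol h_n\to \mathbf 0$ and $n\rho(\boldsymbol h_n)\to\infty$ as $n\to\infty$. For functions $g$ on $\mathbb R_+^r$ let $\lambda_{\boldsymbol d}(g)=\omega_{\boldsymbol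 d-1}\int_{\mathbb R_+^r}g(s)\prod_{j=1}^r s_j^{d_j/2-1}2^{d_j/2-1}\,\mathrm ds$, and put $b_{\boldsymbol d,j}(L)=\dfrac{\lambda_{\boldsymbol d}(L(s)s_j)}{d_j\,\lambda_{\boldsymbol d}(L)}$, $\boldsymbol b_{\boldsymbol d}(L)=(b_{\boldsymbol d,1}(L),\dots,b_{\boldsymbol d,r}(L))'$, $v_{\boldsymbol d}(L)=\dfrac{\lambda_{\boldsymbol d}(L^2)}{\lambda_{\boldsymbol d}(L)^2}$. Let $\boldsymbol{\mathcal T}\bar f(x)=\mathrm{diag}\big(\mathrm{tr}\,\mathcal H_{11}\bar f(x),\dots,\mathrm{tr}\,\mathcal H_{rr}\bar f(x)\big)$, where $\mathcal H_{jj}\bar f(x)$ is the $j$-th diagonal block, of size $(d_j+1)\times(d_j+1)$, of the Hessian matrix of $\bar f$ at $x$, and let $\boldsymbol h_n^{\odot2}=(h_{1,n}^2,\dots,h_{r,n}^2)'$. Then for every $x\in\mathbb S^{\boldsymbol d}$ the random variables $\hat f(x;\boldsymbol h_n)$ are square integrable and, as $n\to\infty$, $$\mathbb E[\hat f(x;\boldsymbol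 h_n)]=f(x)+(\boldsymbol h_n^{\odot2})'\,\boldsymbol{\mathcal T}\bar f(x)\,\boldsymbol b_{\boldsymbol d}(L)+o\Big(\sum_{j=1}^r h_{j,n}^2\Big),$$ $$\mathbb V\mathrm{ar}[\hat f(x;\boldsymbol h_n)]=\frac{v_{\boldsymbol d}(L)}{n\rho(\boldsymbol h_n)}f(x)+o\big((n\rho(\boldsymbol h_n))^{-1}\big).$$ -/

import Mathlib

open MeasureTheory ProbabilityTheory Filter Topology Asymptotics
open scoped Matrix RealInnerProductSpace

noncomputable section

/-- The unit sphere `𝕊^k` of `ℝ^(k+1)`. -/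
abbrev Sph (k : ℕ) : Type := Metric.sphere (0 : EuclideanSpace ℝ (Fin (k + 1))) 1

/-- The surface area measure `σ_k` on `𝕊^k`. -/
def sphMeasure (k : ℕ) : Measure (Sph k) :=
  (volume : Measure (EuclideanSpace ℝ (Fin (k + 1)))).toSphere

/-- The surface area `ω_k = σ_k(𝕊^k)`. -/
def sphArea (k : ℕ) : ℝ := (sphMeasure k).real Set.univ

/-- The polysphere `𝕊^{d_1} × ⋯ × 𝕊^{d_r}`. -/
abbrev Polysphere {r : ℕ} (d : Fin r → ℕ) : Type := (j : Fin r) → Sph (d j)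

/-- The ambient space `ℝ^{d_1+1} × ⋯ × ℝ^{d_r+1}` of the polysphere. -/
abbrev Ambient {r : ℕ} (d : Fin r → ℕ) : Type := (j : Fin r) → EuclideanSpace ℝ (Fin (d j + 1))

/-- The product `σ_d = σ_{d_1} × ⋯ × σ_{d_r}` of the surface area measures. -/
def polyMeasure {r : ℕ} (d : Fin r → ℕ) : Measure (Polysphere d) :=
  Measure.pi fun j => sphMeasure (d j)

/-- `f` is a probability density function on the polysphere with respect to `σ_d`. -/
structure IsDensity {r : ℕ} (d : Fin r → ℕ) (f : Polysphere d → ℝ) : Prop where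
  measurable : Measurable f
  nonneg : ∀ x, 0 ≤ f x
  lintegral_eq_one : ∫⁻ x, ENNReal.ofReal (f x) ∂(polyMeasure d) = 1

/-- The probability distribution on the polysphere with density `f` with respect to `σ_d`. -/
def densityLaw {r : ℕ} (d : Fin r → ℕ) (f : Polysphere d → ℝ) : Measure (Polysphere d) :=
  (polyMeasure d).withDensity fun x => ENNReal.ofReal (f x)

open scoped Classical in
/-- The radial extension `f̄(x) = f(x_1/‖x_1‖, …, x_r/‖x_r‖)` of `f`. It is meaningful on the open
set where no block of `x` vanishes; elsewhere it is given the value `0`. -/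
def radialExt {r : ℕ} {d : Fin r → ℕ} (f : Polysphere d → ℝ) (x : Ambient d) : ℝ :=
  if hx : ∀ j, x j ≠ 0 then
    f fun j => ⟨‖x j‖⁻¹ • x j, by
      rw [mem_sphere_zero_iff_norm]; exact norm_smul_inv_norm (𝕜 := ℝ) (hx j)⟩
  else 0

/-- A point of the polysphere as a vector of the ambient space. -/
def Polysphere.toAmbient {r : ℕ} {d : Fin r → ℕ} (x : Polysphere d) : Ambient d :=
  fun j => (x j : EuclideanSpace ℝ (Fin (d j + 1)))

/-- The radial extension of `f` is twice continuously differentiable on the polysphere, that is,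
in a neighbourhood in the ambient space of each of its points. -/
def RadialExtC2 {r : ℕ} {d : Fin r → ℕ} (f : Polysphere d → ℝ) : Prop :=
  ∀ x : Polysphere d, ContDiffAt ℝ 2 (radialExt f) x.toAmbient

/-- The vector of the canonical basis of the ambient space with the index `(j, a)`. -/
def ambientBasis {r : ℕ} {d : Fin r → ℕ} (p : (j : Fin r) × Fin (d j + 1)) : Ambient d :=
  Pi.single p.1 (EuclideanSpace.single p.2 (1 : ℝ))

/-- The Hessian matrix of `F` at `x`, of second-order partial derivatives. -/
def hessian {r : ℕ} {d : Fin r → ℕ} (F : Ambient d → ℝ) (x : Ambient d) :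
    Matrix ((j : Fin r) × Fin (d j + 1)) ((j : Fin r) × Fin (d j + 1)) ℝ :=
  Matrix.of fun p q => fderiv ℝ (fderiv ℝ F) x (ambientBasis p) (ambientBasis q)

/-- `𝒯F(x) = diag(tr H_11 F(x), …, tr H_rr F(x))`, where `H_jj F(x)` is the `j`-th diagonal block,
of size `d_j + 1`, of the Hessian matrix of `F` at `x`. -/
def traceHess {r : ℕ} {d : Fin r → ℕ} (F : Ambient d → ℝ) (x : Ambient d) :
    Matrix (Fin r) (Fin r) ℝ :=
  Matrix.diagonal fun j => (Matrix.blockDiag' (hessian F x) j).trace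

/-- The open orthant `ℝ_+^r`. -/
def posOrthant (r : ℕ) : Set (Fin r → ℝ) := {s | ∀ j, 0 < s j}

/-- `L` (whose values at points with a negative coordinate play no role) is a bounded kernel
`ℝ_{≥0}^r → ℝ_{≥0}` with `0 < ∫ L^ℓ(s) ∏ s_j^{m_j/2-1} ds < ∞` over the positive orthant for
`ℓ = 1, 2` and all dimensions `m_1, …, m_r ≥ 1`. -/
structure IsKernel {r : ℕ} (L : (Fin r → ℝ) → ℝ) : Prop where
  measurable : Measurable L
  nonneg : ∀ s, (∀ j, 0 ≤ s j) → 0 ≤ L s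
  bounded : ∃ M : ℝ, ∀ s, (∀ j, 0 ≤ s j) → L s ≤ M
  integrableOn : ∀ l : ℕ, l = 1 ∨ l = 2 → ∀ m : Fin r → ℕ, (∀ j, 1 ≤ m j) →
    IntegrableOn (fun s => L s ^ l * ∏ j, s j ^ ((m j : ℝ) / 2 - 1)) (posOrthant r)
  integral_pos : ∀ l : ℕ, l = 1 ∨ l = 2 → ∀ m : Fin r → ℕ, (∀ j, 1 ≤ m j) →
    0 < ∫ s in posOrthant r, L s ^ l * ∏ j, s j ^ ((m j : ℝ) / 2 - 1)

/-- `ρ(h) = ∏ h_j^{d_j}`. -/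
def rho {r : ℕ} (d : Fin r → ℕ) (h : Fin r → ℝ) : ℝ := ∏ j, h j ^ d j

/-- `L((1 - x_1'y_1)/h_1², …, (1 - x_r'y_r)/h_r²)`. -/
def rawKernel {r : ℕ} {d : Fin r → ℕ} (L : (Fin r → ℝ) → ℝ) (h : Fin r → ℝ)
    (x y : Polysphere d) : ℝ :=
  L fun j => (1 - ⟪(x j : EuclideanSpace ℝ (Fin (d j + 1))), (y j)⟫) / h j ^ 2

/-- The normalizing constant `c_{d,L}(h)`, the inverse of the integral of
`L((1 - x_1'y_1)/h_1², …, (1 - x_r'y_r)/h_r²)` in `x` over the polysphere. By the rotation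
invariance of the surface area measures it does not depend on `y`. -/
def normConst {r : ℕ} {d : Fin r → ℕ} (L : (Fin r → ℝ) → ℝ) (h : Fin r → ℝ)
    (y : Polysphere d) : ℝ :=
  (∫ x, rawKernel L h x y ∂(polyMeasure d))⁻¹

/-- The normalized kernel `L_h(x, y)`. -/
def normKernel {r : ℕ} {d : Fin r → ℕ} (L : (Fin r → ℝ) → ℝ) (h : Fin r → ℝ)
    (x y : Polysphere d) : ℝ :=
  normConst L h y * rawKernel L h x y

/-- The kernel density estimator `f̂(x; h) = n⁻¹ ∑ L_h(x, X_i)` from `X_1, …, X_n`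
(numbered from `0` here), as a random variable. -/
def kde {Ω : Type*} {r : ℕ} {d : Fin r → ℕ} (L : (Fin r → ℝ) → ℝ) (X : ℕ → Ω → Polysphere d)
    (n : ℕ) (h : Fin r → ℝ) (x : Polysphere d) (ω : Ω) : ℝ :=
  (1 / (n : ℝ)) * ∑ i ∈ Finset.range n, normKernel L h x (X i ω)

/-- `λ_d(g) = ω_{d-1} ∫ g(s) ∏ s_j^{d_j/2-1} 2^{d_j/2-1} ds` over the positive orthant, where
`ω_{d-1} = ∏ ω_{d_j-1}`. -/
def lam {r : ℕ} (d : Fin r → ℕ) (g : (Fin r → ℝ) → ℝ) : ℝ :=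
  (∏ j, sphArea (d j - 1)) *
    ∫ s in posOrthant r,
      g s * ∏ j, (s j ^ ((d j : ℝ) / 2 - 1) * (2 : ℝ) ^ ((d j : ℝ) / 2 - 1))

/-- `b_{d,j}(L) = λ_d(L(s) s_j) / (d_j λ_d(L))`. -/
def biasMoment {r : ℕ} (d : Fin r → ℕ) (L : (Fin r → ℝ) → ℝ) (j : Fin r) : ℝ :=
  lam d (fun s => L s * s j) / (d j * lam d L)

/-- `v_d(L) = λ_d(L²) / λ_d(L)²`. -/
def varMoment {r : ℕ} (d : Fin r → ℕ) (L : (Fin r → ℝ) → ℝ) : ℝ :=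
  lam d (fun s => L s ^ 2) / lam d L ^ 2

end

open scoped ENNReal Pointwise

/-! Everything is read off from the law, under the surface measure, of the scaled distances S_j = (1
- x_j'y_j)/h_j². On one sphere, polar coordinates about x give S the density ω_{d-1} h^d s^{d/2-1}
(2 - h²s)^{d/2-1} on (0, 2/h²) (`sphMeasure_map_cap`); on the polysphere the densities multiply
(`polyMeasure_map_capVec`). Divided by ρ(h), this weight converges pointwise to the weight in λ_d,
so ρ(h)⁻¹ ∫ G(S) S_j^p dσ tends to λ_d(G s_j^p) for G = L and G = L² (`tendsto_integral_capVec`,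
`tendsto_capMoment`); p = 0 gives the normalizing constant.

The delicate point is that limit. For d_j = 1 the weight is singular at the antipode s = 2/h², while
A2 gives boundedness and moments of the kernel but no pointwise decay. Where all h_j² s_j ≤ 1 the
weight has a fixed majorant. Elsewhere the inequality a v² ≤ a³ + v³ separates the kernel from v =
(2 - h²s)^(-1/4): the kernel term is controlled by moments, and the singular term, now of order (2 -
h²s)^(-3/4), is still integrable, with integral tending to 0 (`far_le`,
`tendsto_integral_farBound`).

For the bias, f is expanded in the tangential part of y at x. The radial extension is constant on
rays, so its first derivative and its pure second derivative vanish in each radial direction: the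
radial part of y - x enters only at higher order, and the trace of a Hessian block over tangent
directions is the full trace. Isometries fixing x preserve both S and the measure. Reflections
therefore kill the linear and the mixed quadratic terms and make the diagonal ones equal within a
factor, each being d_j⁻¹ times the integral of 1 - (x_j'y_j)² = 2h_j²S_j - h_j⁴S_j²
(`integral_mul_sub_eq`). The remainder is o(∑ h_j²) (`isLittleO_integral_tangentRemainder`).

For the variance, independence leaves n⁻¹(E K² - (E K)²) for one normalized kernel K. The first term
is ρ(h)⁻¹ times a convergent quantity, by `tendsto_integral_mul` for L²; the second is bounded,
hence negligible since ρ(h) → 0. -/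

noncomputable section

/-! ### Isometries and polar coordinates on one sphere -/

/-- The action of a linear isometry on the unit sphere. -/
def sphMap {k : ℕ} (φ : EuclideanSpace ℝ (Fin (k + 1)) ≃ₗᵢ[ℝ] EuclideanSpace ℝ (Fin (k + 1)))
    (y : Sph k) : Sph k :=
  ⟨φ y, by rw [mem_sphere_zero_iff_norm, φ.norm_map]; exact norm_eq_of_mem_sphere y⟩

lemma measurable_sphMap {k : ℕ}
    (φ : EuclideanSpace ℝ (Fin (k + 1)) ≃ₗᵢ[ℝ] EuclideanSpace ℝ (Fin (k + 1))) :
    Measurable (sphMap φ) :=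
  (φ.continuous.measurable.comp measurable_subtype_coe).subtype_mk

/-- `toSphere` measures a set through the volume of the cone over it, and a linear isometry carries
cones to cones and preserves volume. -/
lemma measurePreserving_sphMap {k : ℕ}
    (φ : EuclideanSpace ℝ (Fin (k + 1)) ≃ₗᵢ[ℝ] EuclideanSpace ℝ (Fin (k + 1))) :
    MeasurePreserving (sphMap φ) (sphMeasure k) (sphMeasure k) := by
  refine ⟨measurable_sphMap φ, ?_⟩
  ext s hs
  rw [Measure.map_apply (measurable_sphMap φ) hs, sphMeasure,
    Measure.toSphere_apply' _ hs, Measure.toSphere_apply' _ (measurable_sphMap φ hs)]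
  congr 1
  rw [← φ.measurePreserving.measure_preimage_emb φ.toHomeomorph.measurableEmbedding
    (Set.Ioo (0 : ℝ) 1 • (Subtype.val '' s))]
  congr 1
  ext z
  simp only [Set.mem_smul, Set.mem_image, Set.mem_preimage, Subtype.exists, exists_and_right,
    exists_eq_right]
  constructor
  · rintro ⟨c, hc, w, ⟨hw, hs⟩, rfl⟩
    exact ⟨c, hc, φ w, ⟨by simpa using hw, hs⟩, by simp⟩
  · rintro ⟨c, hc, w, ⟨hw, hs⟩, h⟩
    refine ⟨c, hc, φ.symm w, ⟨by simpa using hw, ?_⟩, ?_⟩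
    · simpa [sphMap] using hs
    · apply φ.injective; rw [← h]; simp

lemma lintegral_fun_norm {k : ℕ} {F : ℝ → ℝ≥0∞} (hF : Measurable F) :
    ∫⁻ w : EuclideanSpace ℝ (Fin (k + 1)), F ‖w‖ =
      sphMeasure k Set.univ * ∫⁻ ρ in Set.Ioi (0 : ℝ), ENNReal.ofReal (ρ ^ k) * F ρ := by
  have hmp := (volume : Measure (EuclideanSpace ℝ (Fin (k + 1)))).measurePreserving_homeomorphUnitSphereProd
  have h1 : ∫⁻ w : EuclideanSpace ℝ (Fin (k + 1)), F ‖w‖ =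
      ∫⁻ w : ({0}ᶜ : Set (EuclideanSpace ℝ (Fin (k + 1)))), F ‖w.1‖ ∂(volume.comap Subtype.val) := by
    rw [lintegral_subtype_comap (measurableSet_singleton _).compl (fun w => F ‖w‖),
      restrict_compl_singleton]
  have h2 := hmp.lintegral_comp (f := fun p => F p.2.1)
    (hF.comp (measurable_subtype_coe.comp measurable_snd))
  simp only [homeomorphUnitSphereProd_apply_snd_coe] at h2
  rw [h1, h2, lintegral_prod _ (by fun_prop)]
  simp only [lintegral_const]
  rw [mul_comm, sphMeasure]
  congr 1
  rw [Measure.volumeIoiPow, lintegral_withDensity_eq_lintegral_mul _ (by fun_prop) (by fun_prop)]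
  simp only [finrank_euclideanSpace, Fintype.card_fin, Nat.add_sub_cancel, Pi.mul_apply]
  exact lintegral_subtype_comap measurableSet_Ioi (fun ρ => ENNReal.ofReal (ρ ^ k) * F ρ)


/-- In an orthonormal basis starting with x, write z = (a, w) with a = x'z. Membership in the cone
depends only on a and ‖w‖, so `lintegral_fun_norm` integrates out the direction of w. -/
lemma volume_cone {k : ℕ} (x : Sph (k + 1)) {A : Set ℝ} (hA : MeasurableSet A) :
    volume {z : EuclideanSpace ℝ (Fin (k + 2)) | 0 < ‖z‖ ∧ ‖z‖ < 1 ∧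
        ⟪(x : EuclideanSpace ℝ (Fin (k + 2))), z⟫ / ‖z‖ ∈ A} =
      sphMeasure k Set.univ * ∫⁻ a : ℝ, ∫⁻ ρ in Set.Ioi (0 : ℝ), ENNReal.ofReal (ρ ^ k) *
        {q : ℝ × ℝ | 0 < √(q.1 ^ 2 + q.2 ^ 2) ∧ √(q.1 ^ 2 + q.2 ^ 2) < 1 ∧
          q.1 / √(q.1 ^ 2 + q.2 ^ 2) ∈ A}.indicator 1 (a, ρ) := by
  set Q := {q : ℝ × ℝ | 0 < √(q.1 ^ 2 + q.2 ^ 2) ∧ √(q.1 ^ 2 + q.2 ^ 2) < 1 ∧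
          q.1 / √(q.1 ^ 2 + q.2 ^ 2) ∈ A} with hQ
  have hQm : MeasurableSet Q := by
    have h1 : Measurable fun q : ℝ × ℝ => √(q.1 ^ 2 + q.2 ^ 2) := by fun_prop
    have h2 : Measurable fun q : ℝ × ℝ => q.1 / √(q.1 ^ 2 + q.2 ^ 2) := by fun_prop
    exact (measurableSet_lt measurable_const h1).inter
      ((measurableSet_lt h1 measurable_const).inter (h2 hA))
  obtain ⟨b, hb⟩ : ∃ b : OrthonormalBasis (Fin (k + 2)) ℝ (EuclideanSpace ℝ (Fin (k + 2))),
      ∀ i ∈ ({0} : Set (Fin (k + 2))), b i = x := by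
    refine Orthonormal.exists_orthonormalBasis_extension_of_card_eq (v := fun _ => (x : EuclideanSpace ℝ (Fin (k + 2)))) (by simp) ?_
    constructor
    · intro i; simp [Set.domRestrict]
    · intro i j hij; exact absurd (Subsingleton.elim i j) hij
  have hmp : MeasurePreserving
      (fun w : EuclideanSpace ℝ (Fin (k + 2)) =>
        (w 0, WithLp.toLp 2 (fun i : Fin (k + 1) => w i.succ)))
      volume (volume.prod (volume : Measure (EuclideanSpace ℝ (Fin (k + 1))))) := by
    have e1 := PiLp.volume_preserving_ofLp (Fin (k + 2))
    have e2 := volume_preserving_piFinSuccAbove (fun _ : Fin (k + 2) => ℝ) 0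
    have e3 := (MeasurePreserving.id (volume : Measure ℝ)).prod
      (PiLp.volume_preserving_toLp (Fin (k + 1)))
    exact e3.comp (e2.comp e1)
  have hmp2 := hmp.comp b.measurePreserving_repr
  have hset : {z : EuclideanSpace ℝ (Fin (k + 2)) | 0 < ‖z‖ ∧ ‖z‖ < 1 ∧
        ⟪(x : EuclideanSpace ℝ (Fin (k + 2))), z⟫ / ‖z‖ ∈ A} =
      ((fun w : EuclideanSpace ℝ (Fin (k + 2)) =>
        (w 0, WithLp.toLp 2 (fun i : Fin (k + 1) => w i.succ))) ∘ b.repr) ⁻¹'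
        {p | (p.1, ‖p.2‖) ∈ Q} := by
    ext z
    have hn : ‖z‖ = √((b.repr z 0) ^ 2 +
        ‖(WithLp.toLp 2 (fun i : Fin (k + 1) => b.repr z i.succ) : EuclideanSpace ℝ _)‖ ^ 2) := by
      rw [← b.repr.norm_map z, EuclideanSpace.norm_eq, EuclideanSpace.norm_sq_eq,
        Fin.sum_univ_succ]
      simp
    have h0 : ⟪(x : EuclideanSpace ℝ (Fin (k + 2))), z⟫ = b.repr z 0 := by
      rw [b.repr_apply_apply, hb 0 rfl]
    simp only [Set.mem_ofPred_eq, Set.mem_preimage, Function.comp, hQ, h0, ← hn]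
  have hSm : MeasurableSet {p : ℝ × EuclideanSpace ℝ (Fin (k + 1)) | (p.1, ‖p.2‖) ∈ Q} :=
    (by fun_prop : Measurable fun p : ℝ × EuclideanSpace ℝ (Fin (k + 1)) => (p.1, ‖p.2‖)) hQm
  rw [hset, hmp2.measure_preimage hSm.nullMeasurableSet, Measure.prod_apply hSm,
    ← lintegral_const_mul']
  · congr 1
    ext a
    have hF : Measurable fun ρ : ℝ => Q.indicator (1 : ℝ × ℝ → ℝ≥0∞) (a, ρ) :=
      (measurable_one.indicator hQm).comp (by fun_prop)
    rw [← lintegral_fun_norm hF, ← lintegral_indicator_one (measurable_prodMk_left hSm)]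
    rfl
  · rw [sphMeasure]; exact measure_ne_top _ _

/-- The planar integral for the cone over a cap is computed in polar coordinates a = r cos θ, ‖w‖ =
r sin θ. The radial factor ∫₀¹ r^(k+1) dr = 1/(k+2) cancels the dimension factor in the definition
of `toSphere`. -/
lemma sphMeasure_inner_preimage {k : ℕ} (x : Sph (k + 1)) {A : Set ℝ} (hA : MeasurableSet A) :
    sphMeasure (k + 1) {y | ⟪(x : EuclideanSpace ℝ (Fin (k + 2))), (y : EuclideanSpace ℝ (Fin (k + 2)))⟫ ∈ A} =
      sphMeasure k Set.univ * ∫⁻ θ in Set.Ioo 0 Real.pi, ENNReal.ofReal (Real.sin θ ^ k) *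
        A.indicator 1 (Real.cos θ) := by
  have hm : MeasurableSet {y : Sph (k + 1) | ⟪(x : EuclideanSpace ℝ (Fin (k + 2))), (y : EuclideanSpace ℝ (Fin (k + 2)))⟫ ∈ A} :=
    (by fun_prop : Measurable fun y : Sph (k + 1) => ⟪(x : EuclideanSpace ℝ (Fin (k + 2))), (y : EuclideanSpace ℝ (Fin (k + 2)))⟫) hA
  rw [sphMeasure, Measure.toSphere_apply' _ hm]
  have hset : Set.Ioo (0 : ℝ) 1 • ((↑) '' {y : Sph (k + 1) | ⟪(x : EuclideanSpace ℝ (Fin (k + 2))), (y : EuclideanSpace ℝ (Fin (k + 2)))⟫ ∈ A} : Set (EuclideanSpace ℝ (Fin (k + 2))))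
      = {z : EuclideanSpace ℝ (Fin (k + 2)) | 0 < ‖z‖ ∧ ‖z‖ < 1 ∧
        ⟪(x : EuclideanSpace ℝ (Fin (k + 2))), z⟫ / ‖z‖ ∈ A} := by
    ext z
    constructor
    · rintro ⟨c, hc, _, ⟨y, hy, rfl⟩, rfl⟩
      have hn : ‖c • (y : EuclideanSpace ℝ (Fin (k + 2)))‖ = c := by
        rw [norm_smul, norm_eq_of_mem_sphere, mul_one, Real.norm_of_nonneg hc.1.le]
      refine ⟨?_, ?_, ?_⟩
      · simpa only [hn] using hc.1
      · simpa only [hn] using hc.2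
      · simp only [hn, inner_smul_right]
        rw [mul_div_cancel_left₀ _ hc.1.ne']
        exact hy
    · rintro ⟨h0, h1, h2⟩
      refine ⟨‖z‖, ⟨h0, h1⟩, ‖z‖⁻¹ • z, ⟨⟨‖z‖⁻¹ • z, ?_⟩, ?_, rfl⟩, ?_⟩
      · rw [mem_sphere_zero_iff_norm]
        exact norm_smul_inv_norm (𝕜 := ℝ) (norm_pos_iff.1 h0)
      · simp only [Set.mem_ofPred_eq, inner_smul_right]
        rwa [inv_mul_eq_div]
      · simp only [smul_smul]
        rw [mul_inv_cancel₀ h0.ne', one_smul]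
  rw [hset, volume_cone x hA]
  set Q := {q : ℝ × ℝ | 0 < √(q.1 ^ 2 + q.2 ^ 2) ∧ √(q.1 ^ 2 + q.2 ^ 2) < 1 ∧
          q.1 / √(q.1 ^ 2 + q.2 ^ 2) ∈ A} with hQ
  have hQm : MeasurableSet Q := by
    have h1 : Measurable fun q : ℝ × ℝ => √(q.1 ^ 2 + q.2 ^ 2) := by fun_prop
    have h2 : Measurable fun q : ℝ × ℝ => q.1 / √(q.1 ^ 2 + q.2 ^ 2) := by fun_prop
    exact (measurableSet_lt measurable_const h1).inter
      ((measurableSet_lt h1 measurable_const).inter (h2 hA))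
  have hQi : Measurable (Q.indicator (1 : ℝ × ℝ → ℝ≥0∞)) := measurable_one.indicator hQm
  have hpol : ∫⁻ a : ℝ, ∫⁻ ρ in Set.Ioi (0 : ℝ), ENNReal.ofReal (ρ ^ k) * Q.indicator 1 (a, ρ) =
      (∫⁻ r in Set.Ioo (0 : ℝ) 1, ENNReal.ofReal (r ^ (k + 1))) *
      ∫⁻ θ in Set.Ioo 0 Real.pi, ENNReal.ofReal (Real.sin θ ^ k) * A.indicator 1 (Real.cos θ) := by
    have e1 : ∀ a : ℝ, ∫⁻ ρ in Set.Ioi (0 : ℝ), ENNReal.ofReal (ρ ^ k) * Q.indicator 1 (a, ρ) =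
        ∫⁻ ρ, (Set.Ioi (0 : ℝ)).indicator (fun ρ => ENNReal.ofReal (ρ ^ k) * Q.indicator 1 (a, ρ)) ρ :=
      fun a => (lintegral_indicator measurableSet_Ioi _).symm
    let G : ℝ × ℝ → ℝ≥0∞ := {q : ℝ × ℝ | 0 < q.2}.indicator
      fun q => ENNReal.ofReal (q.2 ^ k) * Q.indicator 1 q
    have hG : Measurable G := by
      refine Measurable.indicator ?_ (measurableSet_lt measurable_const measurable_snd)
      fun_prop
    have e2 : ∫⁻ a : ℝ, ∫⁻ ρ in Set.Ioi (0 : ℝ), ENNReal.ofReal (ρ ^ k) * Q.indicator 1 (a, ρ) =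
        ∫⁻ q, G q := by
      rw [Measure.volume_eq_prod, lintegral_prod _ hG.aemeasurable]
      congr 1
      ext a
      rw [e1]
      rfl
    rw [e2, ← lintegral_comp_polarCoord_symm, polarCoord_target,
      Measure.volume_eq_prod, ← Measure.prod_restrict]
    rw [lintegral_prod _ (Measurable.aemeasurable (by
      have := continuous_polarCoord_symm.measurable
      simp only [smul_eq_mul]
      fun_prop))]
    have e3 : ∀ r ∈ Set.Ioi (0 : ℝ), ∫⁻ θ in Set.Ioo (-Real.pi) Real.pi,
        ENNReal.ofReal r • G (polarCoord.symm (r, θ)) =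
        (Set.Ioo (0 : ℝ) 1).indicator (fun r => ENNReal.ofReal (r ^ (k + 1)) *
          ∫⁻ θ in Set.Ioo 0 Real.pi, ENNReal.ofReal (Real.sin θ ^ k) * A.indicator 1 (Real.cos θ)) r := by
      intro r hr
      have hr : 0 < r := hr
      -- The second coordinate stands for a norm, so only the upper half-plane, θ in (0, π),
      -- contributes. The Jacobian r times (r sin θ)^k gives r^(k+1) sin^k θ.
      have e4 : ∀ θ ∈ Set.Ioo (-Real.pi) Real.pi, ENNReal.ofReal r • G (polarCoord.symm (r, θ)) =
          (Set.Ioo 0 Real.pi).indicator (fun θ => (Set.Ioo (0 : ℝ) 1).indicator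
            (fun r => ENNReal.ofReal (r ^ (k + 1))) r *
            (ENNReal.ofReal (Real.sin θ ^ k) * A.indicator 1 (Real.cos θ))) θ := by
        intro θ hθ
        have hsq : √((r * Real.cos θ) ^ 2 + (r * Real.sin θ) ^ 2) = r := by
          rw [mul_pow, mul_pow, ← mul_add, Real.cos_sq_add_sin_sq, mul_one, Real.sqrt_sq hr.le]
        rw [polarCoord_symm_apply]
        by_cases h0 : θ ∈ Set.Ioo 0 Real.pi
        · have hs : 0 < Real.sin θ := Real.sin_pos_of_mem_Ioo h0
          have hmem : (r * Real.cos θ, r * Real.sin θ) ∈ {q : ℝ × ℝ | 0 < q.2} := mul_pos hr hs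
          rw [Set.indicator_of_mem h0]
          simp only [G]
          rw [Set.indicator_of_mem hmem]
          have hQ' : (r * Real.cos θ, r * Real.sin θ) ∈ Q ↔ r < 1 ∧ Real.cos θ ∈ A := by
            simp only [hQ, Set.mem_ofPred_eq, hsq, mul_div_cancel_left₀ _ hr.ne', hr, true_and]
          by_cases h1 : r < 1
          · rw [Set.indicator_of_mem (show r ∈ Set.Ioo (0 : ℝ) 1 from ⟨hr, h1⟩)]
            by_cases hc : Real.cos θ ∈ A
            · rw [Set.indicator_of_mem (hQ'.2 ⟨h1, hc⟩), Set.indicator_of_mem hc]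
              simp only [Pi.one_apply, mul_one, smul_eq_mul]
              rw [← ENNReal.ofReal_mul hr.le, ← ENNReal.ofReal_mul (by positivity)]
              congr 1
              ring
            · rw [Set.indicator_of_notMem (fun h => hc (hQ'.1 h).2), Set.indicator_of_notMem hc]
              simp
          · rw [Set.indicator_of_notMem (fun h => h1 (hQ'.1 h).1),
              Set.indicator_of_notMem (fun h : r ∈ Set.Ioo (0 : ℝ) 1 => h1 h.2)]
            simp
        · rw [Set.indicator_of_notMem h0]
          have hs : Real.sin θ ≤ 0 := by
            apply Real.sin_nonpos_of_nonpos_of_neg_pi_le _ hθ.1.le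
            by_contra hc
            exact h0 ⟨not_le.1 hc, hθ.2⟩
          have hmem : (r * Real.cos θ, r * Real.sin θ) ∉ {q : ℝ × ℝ | 0 < q.2} :=
            fun h => absurd (show 0 < r * Real.sin θ from h) (not_lt.2 (mul_nonpos_of_nonneg_of_nonpos hr.le hs))
          simp only [G]
          rw [Set.indicator_of_notMem hmem, smul_zero]
      rw [setLIntegral_congr_fun measurableSet_Ioo e4, lintegral_indicator measurableSet_Ioo,
        Measure.restrict_restrict measurableSet_Ioo,
        Set.inter_eq_left.2 (Set.Ioo_subset_Ioo_left (neg_nonpos.2 Real.pi_pos.le)),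
        lintegral_const_mul _ (by
          have : Measurable fun θ => A.indicator (1 : ℝ → ℝ≥0∞) (Real.cos θ) :=
            (measurable_one.indicator hA).comp Real.measurable_cos
          fun_prop)]
      by_cases h1 : r ∈ Set.Ioo (0 : ℝ) 1
      · rw [Set.indicator_of_mem h1, Set.indicator_of_mem h1]
      · rw [Set.indicator_of_notMem h1, Set.indicator_of_notMem h1, zero_mul]
    rw [setLIntegral_congr_fun measurableSet_Ioi e3, lintegral_indicator measurableSet_Ioo,
      Measure.restrict_restrict measurableSet_Ioo, Set.inter_eq_left.2 (fun r hr => hr.1),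
      lintegral_mul_const _ (by fun_prop)]
  have hr : ∫⁻ r in Set.Ioo (0 : ℝ) 1, ENNReal.ofReal (r ^ (k + 1)) =
      ENNReal.ofReal (1 / (k + 2)) := by
    rw [← ofReal_integral_eq_lintegral_ofReal, ← integral_Ioc_eq_integral_Ioo,
      ← intervalIntegral.integral_of_le zero_le_one, integral_pow]
    · congr 1; push_cast; simp; ring
    · exact ((continuous_pow (k + 1)).integrableOn_Icc (a := (0 : ℝ)) (b := 1)).mono_set
        Set.Ioo_subset_Icc_self
    · exact (ae_restrict_mem measurableSet_Ioo).mono fun r hr => pow_nonneg hr.1.le _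
  rw [hpol, hr, mul_left_comm, ← mul_assoc (Nat.cast _)]
  have : ((Module.finrank ℝ (EuclideanSpace ℝ (Fin (k + 1 + 1))) : ℕ) : ℝ≥0∞) * ENNReal.ofReal (1 / (k + 2)) = 1 := by
    rw [finrank_euclideanSpace, Fintype.card_fin, ← ENNReal.ofReal_natCast, ← ENNReal.ofReal_mul (by positivity)]
    push_cast
    rw [← ENNReal.ofReal_one]
    congr 1
    field_simp
    ring
  rw [← mul_assoc, mul_right_comm, mul_assoc, this, mul_one]

/-! ### The scaled distance on one sphere -/

/-- The density on the line of `(1 - x'y) / h²` when `y` follows the surface area measure. -/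
def capDensity (d : ℕ) (h : ℝ) : ℝ → ℝ :=
  (Set.Ioo 0 (2 / h ^ 2)).indicator fun s =>
    sphArea (d - 1) * h ^ d * (s ^ ((d : ℝ) / 2 - 1) * (2 - h ^ 2 * s) ^ ((d : ℝ) / 2 - 1))

lemma sphArea_nonneg (k : ℕ) : 0 ≤ sphArea k := measureReal_nonneg

@[fun_prop]
lemma measurable_capDensity (d : ℕ) (h : ℝ) : Measurable (capDensity d h) := by
  refine Measurable.indicator ?_ measurableSet_Ioo
  fun_prop

lemma capDensity_nonneg (d : ℕ) {h : ℝ} (hh : 0 < h) (s : ℝ) : 0 ≤ capDensity d h s := by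
  refine Set.indicator_nonneg (fun s hs => ?_) s
  have h1 : 0 ≤ 2 - h ^ 2 * s := by
    have := (lt_div_iff₀ (by positivity)).1 hs.2
    linarith
  have := sphArea_nonneg (d - 1)
  have := hs.1
  positivity

lemma image_one_sub_cos {h : ℝ} (hh : 0 < h) :
    (fun θ => (1 - Real.cos θ) / h ^ 2) '' Set.Ioo 0 Real.pi = Set.Ioo 0 (2 / h ^ 2) := by
  ext s
  constructor
  · rintro ⟨θ, hθ, rfl⟩
    have h1 : Real.cos θ < 1 := by
      have := Real.strictAntiOn_cos ⟨le_rfl, Real.pi_pos.le⟩ ⟨hθ.1.le, hθ.2.le⟩ hθ.1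
      simpa using this
    have h2 : -1 < Real.cos θ := by
      have := Real.strictAntiOn_cos ⟨hθ.1.le, hθ.2.le⟩ ⟨Real.pi_pos.le, le_rfl⟩ hθ.2
      simpa using this
    constructor
    · exact div_pos (by linarith) (by positivity)
    · exact div_lt_div_of_pos_right (by linarith) (by positivity)
  · rintro ⟨h0, h1⟩
    have h2 : h ^ 2 * s < 2 := by
      have := (lt_div_iff₀ (by positivity)).1 h1
      linarith
    have h3 : 0 < h ^ 2 * s := by positivity
    refine ⟨Real.arccos (1 - h ^ 2 * s), ⟨Real.arccos_pos.2 (by linarith), ?_⟩, ?_⟩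
    · refine lt_of_le_of_ne (Real.arccos_le_pi _) fun h => ?_
      have := Real.arccos_eq_pi.1 h
      linarith
    · simp only
      rw [Real.cos_arccos (by linarith) (by linarith)]
      field_simp
      ring

/-- The law of `(1 - x'y) / h²` under the surface area measure. -/
lemma sphMeasure_map_cap {d : ℕ} (hd : 1 ≤ d) (x : Sph d) {h : ℝ} (hh : 0 < h) :
    (sphMeasure d).map (fun y : Sph d =>
        (1 - ⟪(x : EuclideanSpace ℝ (Fin (d + 1))), (y : EuclideanSpace ℝ (Fin (d + 1)))⟫) / h ^ 2) =
      volume.withDensity fun s => ENNReal.ofReal (capDensity d h s) := by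
  obtain ⟨k, rfl⟩ : ∃ k, d = k + 1 := ⟨d - 1, by omega⟩
  ext A hA
  have hm : Measurable fun t : ℝ => (1 - t) / h ^ 2 := by fun_prop
  rw [Measure.map_apply (by fun_prop) hA, withDensity_apply _ hA]
  have hpre : (fun y : Sph (k + 1) =>
      (1 - ⟪(x : EuclideanSpace ℝ (Fin (k + 1 + 1))), (y : EuclideanSpace ℝ (Fin (k + 1 + 1)))⟫) / h ^ 2) ⁻¹' A =
      {y : Sph (k + 1) | ⟪(x : EuclideanSpace ℝ (Fin (k + 2))), (y : EuclideanSpace ℝ (Fin (k + 2)))⟫ ∈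
        (fun t : ℝ => (1 - t) / h ^ 2) ⁻¹' A} := rfl
  rw [hpre, sphMeasure_inner_preimage x (hm hA)]
  let g : ℝ → ℝ := fun s => sphArea k * h ^ (k + 1) *
    (s ^ (((k + 1 : ℕ) : ℝ) / 2 - 1) * (2 - h ^ 2 * s) ^ (((k + 1 : ℕ) : ℝ) / 2 - 1))
  have hR : ∫⁻ s in A, ENNReal.ofReal (capDensity (k + 1) h s) =
      ∫⁻ s in Set.Ioo 0 (2 / h ^ 2), A.indicator (fun s => ENNReal.ofReal (g s)) s := by
    rw [← lintegral_indicator hA, ← lintegral_indicator measurableSet_Ioo]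
    congr 1
    ext s
    by_cases h1 : s ∈ A <;> by_cases h2 : s ∈ Set.Ioo 0 (2 / h ^ 2) <;>
      simp only [capDensity, Set.indicator_of_mem, Set.indicator_of_notMem, h1, h2, g,
        Nat.add_sub_cancel, not_false_eq_true, ENNReal.ofReal_zero]
  -- Substitution s = (1 - cos θ)/h², injective on (0, π), with ds = sin θ / h² dθ.
  rw [hR, ← image_one_sub_cos hh, lintegral_image_eq_lintegral_abs_deriv_mul measurableSet_Ioo
    (f' := fun θ => Real.sin θ / h ^ 2)]
  · rw [← lintegral_const_mul']
    · refine setLIntegral_congr_fun measurableSet_Ioo fun θ hθ => ?_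
      have hs : 0 < Real.sin θ := Real.sin_pos_of_mem_Ioo hθ
      have hiff : Real.cos θ ∈ (fun t : ℝ => (1 - t) / h ^ 2) ⁻¹' A ↔ (1 - Real.cos θ) / h ^ 2 ∈ A :=
        Iff.rfl
      by_cases hc : (1 - Real.cos θ) / h ^ 2 ∈ A
      · rw [Set.indicator_of_mem hc, Set.indicator_of_mem (hiff.2 hc)]
        rw [Pi.one_apply, mul_one, abs_of_pos (by positivity), ← ENNReal.ofReal_mul (by positivity),
          ← ENNReal.ofReal_toReal (a := sphMeasure k Set.univ) (by rw [sphMeasure]; exact measure_ne_top _ _),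
          ← ENNReal.ofReal_mul (by positivity)]
        congr 1
        have h1 : 0 < 1 - Real.cos θ := by nlinarith [Real.sin_sq_add_cos_sq θ, Real.cos_le_one θ]
        have h2 : 0 < 1 + Real.cos θ := by nlinarith [Real.sin_sq_add_cos_sq θ, Real.neg_one_le_cos θ]
        have e1 : 2 - h ^ 2 * ((1 - Real.cos θ) / h ^ 2) = 1 + Real.cos θ := by
          field_simp; ring
        simp only [g]
        rw [e1, ← Real.mul_rpow (by positivity) h2.le]
        -- The two powers in the density have the same exponent (k+1)/2 - 1, so they combine to (sin
        -- θ / h)^(k-1); the Jacobian supplies the missing factor sin θ.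
        have e2 : (1 - Real.cos θ) / h ^ 2 * (1 + Real.cos θ) = (Real.sin θ / h) ^ (2 : ℝ) := by
          rw [Real.rpow_two, div_pow, Real.sin_sq]; field_simp; ring
        rw [e2, ← Real.rpow_mul (by positivity)]
        have e3 : (2 : ℝ) * (((k + 1 : ℕ) : ℝ) / 2 - 1) = k - 1 := by push_cast; ring
        rw [e3, Real.rpow_sub_one (by positivity), Real.rpow_natCast]
        change sphArea k * _ = _
        rw [div_pow]
        field_simp
        ring
      · rw [Set.indicator_of_notMem hc, Set.indicator_of_notMem (mt hiff.1 hc)]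
        simp
    · rw [sphMeasure]; exact measure_ne_top _ _
  · intro θ _
    have := ((Real.hasDerivAt_cos θ).const_sub 1).div_const (h ^ 2)
    simpa using this.hasDerivWithinAt
  · intro a ha b hb hab
    have : Real.cos a = Real.cos b := by
      have h0 : h ^ 2 ≠ 0 := by positivity
      simpa [h0] using (div_left_inj' h0).1 hab
    exact Real.injOn_cos ⟨ha.1.le, ha.2.le⟩ ⟨hb.1.le, hb.2.le⟩ this

/-! ### Product densities and the scaled distances on the polysphere -/

lemma lintegral_fin_prod {n : ℕ} {f : Fin n → ℝ → ℝ≥0∞} (hf : ∀ i, Measurable (f i)) :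
    ∫⁻ x : Fin n → ℝ, ∏ i, f i (x i) = ∏ i, ∫⁻ t, f i t := by
  induction n with
  | zero => simp [Measure.volume_pi_eq_dirac 0]
  | succ n ih =>
    have e := (volume_preserving_piFinSuccAbove (fun _ : Fin (n + 1) => ℝ) 0).symm
    rw [← e.lintegral_comp (by fun_prop), Measure.volume_eq_prod, lintegral_prod]
    · rw [Fin.prod_univ_succ, ← ih fun i => hf i.succ, ← lintegral_mul_const _ (hf 0)]
      congr 1
      ext t
      rw [← lintegral_const_mul _ (by fun_prop)]
      congr 1
      ext y
      rw [Fin.prod_univ_succ]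
      simp [MeasurableEquiv.piFinSuccAbove]
    · fun_prop

lemma pi_withDensity_real {n : ℕ} {f : Fin n → ℝ → ℝ≥0∞} (hf : ∀ i, Measurable (f i))
    [∀ i, SigmaFinite ((volume : Measure ℝ).withDensity (f i))] :
    Measure.pi (fun i => (volume : Measure ℝ).withDensity (f i)) =
      (volume : Measure (Fin n → ℝ)).withDensity fun x => ∏ i, f i (x i) := by
  refine Measure.pi_eq fun s hs => ?_
  rw [withDensity_apply _ (MeasurableSet.univ_pi hs),
    ← lintegral_indicator (MeasurableSet.univ_pi hs)]
  have : ∀ x : Fin n → ℝ, (Set.univ.pi s).indicator (fun x => ∏ i, f i (x i)) x =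
      ∏ i, (s i).indicator (f i) (x i) := by
    intro x
    by_cases hx : x ∈ Set.univ.pi s
    · rw [Set.indicator_of_mem hx]
      exact Finset.prod_congr rfl fun i _ => (Set.indicator_of_mem (hx i trivial) _).symm
    · rw [Set.indicator_of_notMem hx]
      simp only [Set.mem_univ_pi, not_forall] at hx
      obtain ⟨i, hi⟩ := hx
      exact (Finset.prod_eq_zero (Finset.mem_univ i) (Set.indicator_of_notMem hi _)).symm
  simp_rw [this]
  rw [lintegral_fin_prod fun i => (hf i).indicator (hs i)]
  exact Finset.prod_congr rfl fun i _ => by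
    rw [lintegral_indicator (hs i), withDensity_apply _ (hs i)]

/-- The vector of the scaled distances `(1 - x_j'y_j) / h_j²`. -/
def capVec {r : ℕ} {d : Fin r → ℕ} (h : Fin r → ℝ) (x y : Polysphere d) : Fin r → ℝ :=
  fun j => (1 - ⟪(x j : EuclideanSpace ℝ (Fin (d j + 1))), (y j)⟫) / h j ^ 2

instance (k : ℕ) : IsFiniteMeasure (sphMeasure k) := by rw [sphMeasure]; infer_instance

instance {r : ℕ} (d : Fin r → ℕ) : IsFiniteMeasure (polyMeasure d) := by
  rw [polyMeasure]; infer_instance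

lemma measurable_capVec {r : ℕ} {d : Fin r → ℕ} (h : Fin r → ℝ) (x : Polysphere d) :
    Measurable (capVec h x) := by
  refine measurable_pi_lambda _ fun j => ?_
  unfold capVec
  fun_prop

/-- The law of `capVec h x` under the surface area measure of the polysphere. -/
lemma polyMeasure_map_capVec {r : ℕ} {d : Fin r → ℕ} (hd : ∀ j, 1 ≤ d j) {h : Fin r → ℝ}
    (hh : ∀ j, 0 < h j) (x : Polysphere d) :
    (polyMeasure d).map (capVec h x) =
      volume.withDensity fun s => ENNReal.ofReal (∏ j, capDensity (d j) (h j) (s j)) := by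
  have hfin : ∀ j, IsFiniteMeasure ((volume : Measure ℝ).withDensity
      fun s => ENNReal.ofReal (capDensity (d j) (h j) s)) := fun j => by
    rw [← sphMeasure_map_cap (hd j) (x j) (hh j)]; infer_instance
  have h1 := pi_withDensity_real (f := fun j s => ENNReal.ofReal (capDensity (d j) (h j) s))
    fun j => (measurable_capDensity _ _).ennreal_ofReal
  simp_rw [ENNReal.ofReal_prod_of_nonneg fun j _ => capDensity_nonneg (d j) (hh j) _]
  rw [← h1, polyMeasure]
  simp_rw [← sphMeasure_map_cap (hd _) (x _) (hh _)]
  have : ∀ j, SigmaFinite ((sphMeasure (d j)).map (fun y : Sph (d j) =>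
    (1 - ⟪(x j : EuclideanSpace ℝ (Fin (d j + 1))), (y : EuclideanSpace ℝ (Fin (d j + 1)))⟫) / h j ^ 2)) := fun j => inferInstance
  rw [← Measure.pi_map_pi fun j => by fun_prop]
  congr 1

/-- Turns integrals over the polysphere into integrals over a fixed Euclidean space. The result does
not involve x, which is why the normalizing constant is independent of the centre. -/
lemma integral_capVec {r : ℕ} {d : Fin r → ℕ} (hd : ∀ j, 1 ≤ d j) {h : Fin r → ℝ}
    (hh : ∀ j, 0 < h j) (x : Polysphere d) {G : (Fin r → ℝ) → ℝ} (hG : Measurable G) :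
    ∫ y, G (capVec h x y) ∂(polyMeasure d) =
      ∫ s, (∏ j, capDensity (d j) (h j) (s j)) * G s := by
  rw [← integral_map (measurable_capVec h x).aemeasurable hG.aestronglyMeasurable,
    polyMeasure_map_capVec hd hh, integral_withDensity_eq_integral_toReal_smul₀]
  · congr 1
    ext s
    rw [ENNReal.toReal_ofReal (Finset.prod_nonneg fun j _ => capDensity_nonneg (d j) (hh j) _),
      smul_eq_mul]
  · exact (Measurable.ennreal_ofReal (by fun_prop)).aemeasurable
  · simp

/-! ### Kernels with moments: L and L² treated together -/

/-- A bounded nonnegative function on the orthant with finite moments of all half-integer orders. -/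
structure HasMoments {r : ℕ} (G : (Fin r → ℝ) → ℝ) : Prop where
  measurable : Measurable G
  nonneg : ∀ s, (∀ j, 0 ≤ s j) → 0 ≤ G s
  bounded : ∃ M : ℝ, ∀ s, (∀ j, 0 ≤ s j) → G s ≤ M
  integrableOn : ∀ m : Fin r → ℕ, (∀ j, 1 ≤ m j) →
    IntegrableOn (fun s => G s * ∏ j, s j ^ ((m j : ℝ) / 2 - 1)) (posOrthant r)

lemma IsKernel.hasMoments {r : ℕ} {L : (Fin r → ℝ) → ℝ} (hL : IsKernel L) : HasMoments L where
  measurable := hL.measurable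
  nonneg := hL.nonneg
  bounded := hL.bounded
  integrableOn m hm := by simpa using hL.integrableOn 1 (Or.inl rfl) m hm

lemma IsKernel.hasMoments_sq {r : ℕ} {L : (Fin r → ℝ) → ℝ} (hL : IsKernel L) :
    HasMoments fun s => L s ^ 2 where
  measurable := hL.measurable.pow_const 2
  nonneg s _ := sq_nonneg _
  bounded := by
    obtain ⟨M, hM⟩ := hL.bounded
    exact ⟨M ^ 2, fun s hs => pow_le_pow_left₀ (hL.nonneg s hs) (hM s hs) 2⟩
  integrableOn m hm := hL.integrableOn 2 (Or.inr rfl) m hm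

lemma measurableSet_posOrthant (r : ℕ) : MeasurableSet (posOrthant r) := by
  have : posOrthant r = ⋂ j, {s | 0 < s j} := by ext; simp [posOrthant]
  rw [this]
  exact MeasurableSet.iInter fun j => measurableSet_lt measurable_const (measurable_pi_apply j)

/-- Multiplying by s_j^p replaces m_j by m_j + 2p, again an admissible dimension. After binomial
expansion every polynomial weight is thus covered by the moment assumption, which is where its
validity for all dimensions is needed. -/
lemma HasMoments.integrableOn_prod_pow {r : ℕ} {G : (Fin r → ℝ) → ℝ} (hG : HasMoments G)
    (m : Fin r → ℕ) (hm : ∀ j, 1 ≤ m j) (N : Fin r → ℕ) :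
    IntegrableOn (fun s => G s * (∏ j, (1 + s j) ^ N j) * ∏ j, s j ^ ((m j : ℝ) / 2 - 1))
      (posOrthant r) := by
  have key : IntegrableOn (fun s => ∑ p ∈ Fintype.piFinset fun j => Finset.range (N j + 1),
      (∏ j, ((N j).choose (p j) : ℝ)) *
        (G s * ∏ j, s j ^ (((m j + 2 * p j : ℕ) : ℝ) / 2 - 1))) (posOrthant r) := by
    refine integrable_finsetSum _ fun p _ => ?_
    exact (hG.integrableOn _ fun j => (hm j).trans (Nat.le_add_right _ _)).const_mul _
  refine key.congr_fun (fun s hs => ?_) (measurableSet_posOrthant r)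
  have h1 : ∏ j, (1 + s j) ^ N j = ∑ p ∈ Fintype.piFinset fun j => Finset.range (N j + 1),
      ∏ j, (s j ^ p j * ((N j).choose (p j) : ℝ)) := by
    rw [← Finset.prod_univ_sum (fun j => Finset.range (N j + 1))
      fun j k => s j ^ k * ((N j).choose k : ℝ)]
    refine Finset.prod_congr rfl fun j _ => ?_
    rw [add_comm, add_pow]
    simp
  simp only
  rw [h1, Finset.mul_sum, Finset.sum_mul]
  refine Finset.sum_congr rfl fun p _ => ?_
  have h2 : ∀ j, s j ^ (((m j + 2 * p j : ℕ) : ℝ) / 2 - 1) = s j ^ p j * s j ^ ((m j : ℝ) / 2 - 1) := by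
    intro j
    rw [← Real.rpow_natCast, ← Real.rpow_add (hs j)]
    congr 1
    push_cast
    ring
  simp_rw [h2, Finset.prod_mul_distrib]
  ring

/-! ### Weights, their limit and their majorants -/

/-- The density of `(1 - x'y) / h²` under the surface area measure, divided by `h ^ d`. -/
def capWeight (d : ℕ) (h : ℝ) : ℝ → ℝ :=
  (Set.Ioo 0 (2 / h ^ 2)).indicator fun s =>
    sphArea (d - 1) * (s ^ ((d : ℝ) / 2 - 1) * (2 - h ^ 2 * s) ^ ((d : ℝ) / 2 - 1))

/-- The pointwise limit of `capWeight d h` as `h → 0`. -/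
def limWeight (d : ℕ) : ℝ → ℝ :=
  (Set.Ioi 0).indicator fun s =>
    sphArea (d - 1) * (s ^ ((d : ℝ) / 2 - 1) * 2 ^ ((d : ℝ) / 2 - 1))

lemma capDensity_eq (d : ℕ) (h s : ℝ) : capDensity d h s = h ^ d * capWeight d h s := by
  by_cases hs : s ∈ Set.Ioo 0 (2 / h ^ 2)
  · rw [capDensity, capWeight, Set.indicator_of_mem hs, Set.indicator_of_mem hs]; ring
  · rw [capDensity, capWeight, Set.indicator_of_notMem hs, Set.indicator_of_notMem hs]; ring

@[fun_prop]
lemma measurable_capWeight (d : ℕ) (h : ℝ) : Measurable (capWeight d h) := by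
  refine Measurable.indicator ?_ measurableSet_Ioo
  fun_prop

lemma capWeight_nonneg (d : ℕ) {h : ℝ} (hh : 0 < h) (s : ℝ) : 0 ≤ capWeight d h s := by
  have h1 := capDensity_nonneg d hh s
  rw [capDensity_eq] at h1
  exact nonneg_of_mul_nonneg_right h1 (by positivity)

lemma mem_Ioo_two_div {h s : ℝ} (hh : 0 < h) : s ∈ Set.Ioo 0 (2 / h ^ 2) ↔ 0 < s ∧ h ^ 2 * s < 2 := by
  rw [Set.mem_Ioo, lt_div_iff₀ (by positivity), mul_comm]

/-- Here 2 - h²s lies in [1, 2], so its power is at most 2^d whatever the sign of the exponent. -/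
lemma capWeight_le_of_le_one {d : ℕ} {h s : ℝ} (hs : 0 < s) (h1 : h ^ 2 * s ≤ 1) :
    capWeight d h s ≤ sphArea (d - 1) * 2 ^ d * s ^ ((d : ℝ) / 2 - 1) := by
  have hA := sphArea_nonneg (d - 1)
  rw [capWeight]
  refine Set.indicator_apply_le' (fun _ => ?_) fun _ => by positivity
  have h2 : (2 - h ^ 2 * s) ^ ((d : ℝ) / 2 - 1) ≤ 2 ^ d := by
    calc (2 - h ^ 2 * s) ^ ((d : ℝ) / 2 - 1) ≤ (2 - h ^ 2 * s) ^ (d : ℝ) := by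
          apply Real.rpow_le_rpow_of_exponent_le (by linarith)
          have : (0 : ℝ) ≤ d := Nat.cast_nonneg d
          linarith
      _ ≤ 2 ^ d := by
          rw [Real.rpow_natCast]
          exact pow_le_pow_left₀ (by linarith) (by nlinarith [sq_nonneg h]) d
  calc _ ≤ sphArea (d - 1) * (s ^ ((d : ℝ) / 2 - 1) * 2 ^ d) := by gcongr
    _ = _ := by ring

/-- Since d ≥ 1 the exponent d/2 - 1 is at least -1/2. The worst singularity is written as the
square of a (-1/4)-th power to fit `mul_sq_le_cube_add_cube`. -/
lemma capWeight_le {d : ℕ} (hd : 1 ≤ d) {h s : ℝ} (hs : 0 < s) (h1 : h ^ 2 * s < 2) :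
    capWeight d h s ≤ sphArea (d - 1) * 2 ^ d *
      (s ^ ((d : ℝ) / 2 - 1) * ((2 - h ^ 2 * s) ^ (-(1 / 4) : ℝ)) ^ 2) := by
  have hA := sphArea_nonneg (d - 1)
  have h0 : 0 < 2 - h ^ 2 * s := by linarith
  have hd' : (1 : ℝ) ≤ d := by exact_mod_cast hd
  rw [capWeight]
  refine Set.indicator_apply_le' (fun _ => ?_) fun _ => by positivity
  have h2 : (2 - h ^ 2 * s) ^ ((d : ℝ) / 2 - 1) ≤ 2 ^ d * ((2 - h ^ 2 * s) ^ (-(1 / 4) : ℝ)) ^ 2 := by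
    have e : (2 - h ^ 2 * s) ^ ((d : ℝ) / 2 - 1) =
        (2 - h ^ 2 * s) ^ (((d : ℝ) - 1) / 2) * ((2 - h ^ 2 * s) ^ (-(1 / 4) : ℝ)) ^ 2 := by
      generalize 2 - h ^ 2 * s = b at h0
      rw [← Real.rpow_natCast, ← Real.rpow_mul h0.le, ← Real.rpow_add h0]
      congr 1; push_cast; ring
    rw [e]
    gcongr
    calc (2 - h ^ 2 * s) ^ (((d : ℝ) - 1) / 2) ≤ 2 ^ (((d : ℝ) - 1) / 2) := by
          apply Real.rpow_le_rpow h0.le (by nlinarith [sq_nonneg h]) (by linarith)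
      _ ≤ 2 ^ (d : ℝ) := Real.rpow_le_rpow_of_exponent_le (by norm_num) (by linarith)
      _ = 2 ^ d := Real.rpow_natCast _ _
  calc _ ≤ sphArea (d - 1) * (s ^ ((d : ℝ) / 2 - 1) * (2 ^ d * ((2 - h ^ 2 * s) ^ (-(1 / 4) : ℝ)) ^ 2)) := by
        gcongr
    _ = _ := by ring

/-- A crude form of Young's inequality with exponents 3 and 3/2. With v a (-1/4)-th power, v³ has
exponent -3/4 > -1 and stays integrable. -/
lemma mul_sq_le_cube_add_cube {a v : ℝ} (ha : 0 ≤ a) (hv : 0 ≤ v) : a * v ^ 2 ≤ a ^ 3 + v ^ 3 := by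
  rcases le_total a v with h | h
  · nlinarith [pow_nonneg ha 3, mul_le_mul_of_nonneg_right h (sq_nonneg v)]
  · have : v ^ 2 ≤ a ^ 2 := pow_le_pow_left₀ hv h 2
    nlinarith [pow_nonneg hv 3, mul_le_mul_of_nonneg_left this ha]

/-- An integrable majorant on the half-line, independent of the bandwidth. -/
def halfLineBound (d : ℕ) : ℝ → ℝ :=
  (Set.Ioi 0).indicator fun s => s ^ ((d : ℝ) / 2 - 1) / (1 + s) ^ (3 * (d + 2))

/-- A majorant concentrated near the antipodal point. -/
def antipodalBound (h : ℝ) : ℝ → ℝ :=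
  (Set.Ioo (1 / h ^ 2) (2 / h ^ 2)).indicator fun s =>
    h ^ 4 * (2 - h ^ 2 * s) ^ (-(3 / 4) : ℝ)

lemma halfLineBound_nonneg (d : ℕ) (s : ℝ) : 0 ≤ halfLineBound d s :=
  Set.indicator_nonneg (fun s (hs : 0 < s) => by positivity) s

lemma antipodalBound_nonneg {h : ℝ} (hh : 0 < h) (s : ℝ) : 0 ≤ antipodalBound h s := by
  refine Set.indicator_nonneg (fun s hs => ?_) s
  have h1 : 0 < 2 - h ^ 2 * s := by
    have := (lt_div_iff₀ (by positivity)).1 hs.2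
    linarith
  positivity

lemma integrable_halfLineBound {d : ℕ} (hd : 1 ≤ d) : Integrable (halfLineBound d) := by
  have hd' : (1 : ℝ) ≤ d := by exact_mod_cast hd
  rw [halfLineBound, integrable_indicator_iff measurableSet_Ioi,
    ← Set.Ioc_union_Ioi_eq_Ioi zero_le_one, integrableOn_union]
  have hm : Measurable fun s : ℝ => s ^ ((d : ℝ) / 2 - 1) / (1 + s) ^ (3 * (d + 2)) := by fun_prop
  constructor
  · have h1 : IntegrableOn (fun s : ℝ => s ^ ((d : ℝ) / 2 - 1)) (Set.Ioc 0 1) := by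
      rw [← intervalIntegrable_iff_integrableOn_Ioc_of_le zero_le_one]
      exact intervalIntegral.intervalIntegrable_rpow' (by linarith)
    refine Integrable.mono' h1 hm.aestronglyMeasurable ?_
    refine (ae_restrict_mem measurableSet_Ioc).mono fun s hs => ?_
    have hs0 := hs.1
    rw [Real.norm_of_nonneg (by positivity)]
    exact div_le_self (by positivity) (one_le_pow₀ (by linarith))
  · have h1 : IntegrableOn (fun s : ℝ => s ^ (-2 : ℝ)) (Set.Ioi 1) :=
      integrableOn_Ioi_rpow_of_lt (by norm_num) one_pos
    refine Integrable.mono' h1 hm.aestronglyMeasurable ?_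
    refine (ae_restrict_mem measurableSet_Ioi).mono fun s (hs : 1 < s) => ?_
    have hs0 : 0 < s := by linarith
    rw [Real.norm_of_nonneg (by positivity), div_le_iff₀ (by positivity)]
    calc s ^ ((d : ℝ) / 2 - 1) ≤ s ^ (-2 + ((3 * (d + 2) : ℕ) : ℝ)) := by
          apply Real.rpow_le_rpow_of_exponent_le hs.le
          push_cast
          linarith
      _ = s ^ (-2 : ℝ) * s ^ (3 * (d + 2)) := by rw [Real.rpow_add hs0, Real.rpow_natCast]
      _ ≤ _ := by gcongr; linarith

/-- The substitution t = 2 - h²s maps the interval to (0, 1) and costs h⁻²; then ∫₀¹ t^(-3/4) dt =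
4. -/
lemma integral_antipodalBound {h : ℝ} (hh : 0 < h) :
    Integrable (antipodalBound h) ∧ ∫ s, antipodalBound h s = 4 * h ^ 2 := by
  have hle : 1 / h ^ 2 ≤ 2 / h ^ 2 := by gcongr; norm_num
  have h0 : h ^ 2 ≠ 0 := by positivity
  have e1 : h ^ 2 * (1 / h ^ 2) = 1 := by field_simp
  have e2 : h ^ 2 * (2 / h ^ 2) = 2 := by field_simp
  have hi : IntervalIntegrable (fun s : ℝ => s ^ (-(3 / 4) : ℝ)) volume (2 - 1) (2 - 2) :=
    intervalIntegral.intervalIntegrable_rpow' (by norm_num)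
  constructor
  · rw [antipodalBound, integrable_indicator_iff measurableSet_Ioo, ← integrableOn_Ioc_iff_integrableOn_Ioo,
      ← intervalIntegrable_iff_integrableOn_Ioc_of_le hle]
    apply IntervalIntegrable.const_mul
    have h1 := (hi.comp_sub_left 2).symm
    have h2 := h1.comp_mul_left (c := h ^ 2)
    simp only [sub_sub_cancel] at h2
    exact h2.symm
  · rw [antipodalBound, integral_indicator measurableSet_Ioo, ← integral_Ioc_eq_integral_Ioo,
      ← intervalIntegral.integral_of_le hle, intervalIntegral.integral_const_mul,
      intervalIntegral.integral_comp_sub_mul (fun s => s ^ (-(3 / 4) : ℝ)) h0, e1, e2,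
      integral_rpow (Or.inl (by norm_num))]
    norm_num
    field_simp

/-- When h²s ≤ 1 the singular factor is at most 1, leaving `halfLineBound`. When h²s > 1, s is large
and the denominator (1 + s)^(3(d+2)) has powers to spare, which are traded for the small factor h⁴.
-/
lemma singular_le_bounds {d : ℕ} (hd : 1 ≤ d) {h s : ℝ} (hh : 0 < h) (hh1 : h ≤ 1) (hs : 0 < s)
    (h1 : h ^ 2 * s < 2) :
    s ^ ((d : ℝ) / 2 - 1) * ((2 - h ^ 2 * s) ^ (-(1 / 4) : ℝ)) ^ 3 / (1 + s) ^ (3 * (d + 2)) ≤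
      halfLineBound d s + antipodalBound h s ∧
    (1 < h ^ 2 * s → s ^ ((d : ℝ) / 2 - 1) * ((2 - h ^ 2 * s) ^ (-(1 / 4) : ℝ)) ^ 3 /
      (1 + s) ^ (3 * (d + 2)) ≤ antipodalBound h s) := by
  have h0 : 0 < 2 - h ^ 2 * s := by linarith
  have hd' : (1 : ℝ) ≤ d := by exact_mod_cast hd
  have tail : 1 < h ^ 2 * s → s ^ ((d : ℝ) / 2 - 1) * ((2 - h ^ 2 * s) ^ (-(1 / 4) : ℝ)) ^ 3 /
      (1 + s) ^ (3 * (d + 2)) ≤ antipodalBound h s := by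
    intro hs1
    have hmem : s ∈ Set.Ioo (1 / h ^ 2) (2 / h ^ 2) := by
      constructor
      · rw [div_lt_iff₀ (by positivity)]; linarith
      · rw [lt_div_iff₀ (by positivity)]; linarith
    rw [antipodalBound, Set.indicator_of_mem hmem]
    have e : ((2 - h ^ 2 * s) ^ (-(1 / 4) : ℝ)) ^ 3 = (2 - h ^ 2 * s) ^ (-(3 / 4) : ℝ) := by
      generalize 2 - h ^ 2 * s = b at h0
      rw [← Real.rpow_natCast, ← Real.rpow_mul h0.le]; norm_num
    rw [e, mul_div_right_comm]
    gcongr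
    have hs2 : 1 ≤ s := by nlinarith [pow_le_one₀ hh.le hh1 (n := 2)]
    rw [div_le_iff₀ (by positivity)]
    -- Two of the spare powers of s become h⁴, enough to beat the length of order h⁻² of the
    -- antipodal interval.
    have h4 : 1 ≤ h ^ 4 * s ^ 2 := by nlinarith
    calc s ^ ((d : ℝ) / 2 - 1) ≤ s ^ (((3 * (d + 2) : ℕ) : ℝ) - 2) := by
          apply Real.rpow_le_rpow_of_exponent_le hs2
          push_cast
          linarith
      _ ≤ s ^ (((3 * (d + 2) : ℕ) : ℝ) - 2) * (h ^ 4 * s ^ 2) :=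
          le_mul_of_one_le_right (by positivity) h4
      _ = h ^ 4 * s ^ (3 * (d + 2)) := by
          rw [Real.rpow_sub hs, Real.rpow_natCast, Real.rpow_two]; field_simp
      _ ≤ _ := by gcongr; linarith
  refine ⟨?_, tail⟩
  rcases le_or_gt (h ^ 2 * s) 1 with hc | hc
  · refine le_add_of_le_of_nonneg ?_ (antipodalBound_nonneg hh s)
    rw [halfLineBound, Set.indicator_of_mem (show s ∈ Set.Ioi 0 from hs)]
    gcongr
    refine mul_le_of_le_one_right (by positivity) (pow_le_one₀ (by positivity) ?_)
    exact Real.rpow_le_one_of_one_le_of_nonpos (by linarith) (by norm_num)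
  · exact le_add_of_nonneg_of_le (halfLineBound_nonneg d s) (tail hc)

/-- The points of the orthant which correspond to distances at most `1` from the centre. -/
def nearSet {r : ℕ} (h : Fin r → ℝ) : Set (Fin r → ℝ) := {s | ∀ j, h j ^ 2 * s j ≤ 1}

lemma measurableSet_nearSet {r : ℕ} (h : Fin r → ℝ) : MeasurableSet (nearSet h) := by
  have : nearSet h = ⋂ j, {s | h j ^ 2 * s j ≤ 1} := by ext; simp [nearSet]
  rw [this]
  exact MeasurableSet.iInter fun j => measurableSet_le (by fun_prop) measurable_const

lemma prod_capWeight_eq_zero {r : ℕ} (d : Fin r → ℕ) {h : Fin r → ℝ} (hh : ∀ j, 0 < h j)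
    {s : Fin r → ℝ} (hs : ¬ ∀ j, 0 < s j ∧ h j ^ 2 * s j < 2) :
    ∏ j, capWeight (d j) (h j) (s j) = 0 := by
  push Not at hs
  obtain ⟨j, hj⟩ := hs
  refine Finset.prod_eq_zero (Finset.mem_univ j) (Set.indicator_of_notMem ?_ _)
  rw [mem_Ioo_two_div (hh j)]
  exact fun h => not_lt.2 (hj h.1) h.2

/-- The majorant of the singular part of the integrand away from `nearSet h`. -/
def farBound {r : ℕ} (d : Fin r → ℕ) (h : Fin r → ℝ) (s : Fin r → ℝ) : ℝ :=
  ∑ i, ∏ j, (if j = i then antipodalBound (h j) (s j)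
    else halfLineBound (d j) (s j) + antipodalBound (h j) (s j))

lemma integral_farBound {r : ℕ} {d : Fin r → ℕ} (hd : ∀ j, 1 ≤ d j) {h : Fin r → ℝ}
    (hh : ∀ j, 0 < h j) :
    Integrable (farBound d h) ∧ ∫ s, farBound d h s =
      ∑ i, ∏ j, (if j = i then 4 * h j ^ 2 else (∫ t, halfLineBound (d j) t) + 4 * h j ^ 2) := by
  have h1 : ∀ i j : Fin r, Integrable (fun t : ℝ => if j = i then antipodalBound (h j) t
      else halfLineBound (d j) t + antipodalBound (h j) t) := by
    intro i j
    split_ifs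
    · exact (integral_antipodalBound (hh j)).1
    · exact (integrable_halfLineBound (hd j)).add (integral_antipodalBound (hh j)).1
  have h2 : ∀ i : Fin r, Integrable (fun s : Fin r → ℝ => ∏ j, (if j = i then antipodalBound (h j) (s j)
      else halfLineBound (d j) (s j) + antipodalBound (h j) (s j))) := fun i =>
    Integrable.fintype_prod (f := fun j t => if j = i then antipodalBound (h j) t
      else halfLineBound (d j) t + antipodalBound (h j) t) (h1 i)
  refine ⟨integrable_finsetSum _ fun i _ => h2 i, ?_⟩
  simp only [farBound]
  rw [integral_finsetSum _ fun i _ => h2 i]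
  refine Finset.sum_congr rfl fun i _ => ?_
  rw [integral_fintype_prod_volume_eq_prod (fun j t => if j = i then antipodalBound (h j) t
      else halfLineBound (d j) t + antipodalBound (h j) t)]
  refine Finset.prod_congr rfl fun j _ => ?_
  split_ifs
  · exact (integral_antipodalBound (hh j)).2
  · rw [integral_add (integrable_halfLineBound (hd j)) (integral_antipodalBound (hh j)).1,
      (integral_antipodalBound (hh j)).2]

/-- In the summand i, the factor of index i tends to 0 while all the others converge. -/
lemma tendsto_integral_farBound {r : ℕ} {d : Fin r → ℕ} (hd : ∀ j, 1 ≤ d j) {h : ℕ → Fin r → ℝ}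
    (hpos : ∀ n j, 0 < h n j) (hlim : Tendsto h atTop (𝓝 0)) :
    Tendsto (fun n => ∫ s, farBound d (h n) s) atTop (𝓝 0) := by
  simp_rw [fun n => (integral_farBound hd (hpos n)).2]
  have hj : ∀ j, Tendsto (fun n => 4 * h n j ^ 2) atTop (𝓝 0) := fun j => by
    have := ((tendsto_pi_nhds.1 hlim j).pow 2).const_mul 4
    simpa using this
  have : (0 : ℝ) = ∑ i : Fin r, ∏ j : Fin r, (if j = i then 0 else (∫ t, halfLineBound (d j) t) + 0) := by
    symm
    refine Finset.sum_eq_zero fun i _ => Finset.prod_eq_zero (Finset.mem_univ i) (by simp)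
  rw [this]
  refine tendsto_finsetSum _ fun i _ => tendsto_finsetProd _ fun j _ => ?_
  split_ifs
  · exact hj j
  · exact (hj j).const_add _

/-- The fixed integrable majorant of the rescaled integrand. -/
def momentBound {r : ℕ} (d : Fin r → ℕ) (G : (Fin r → ℝ) → ℝ) (N : Fin r → ℕ) :
    (Fin r → ℝ) → ℝ :=
  (posOrthant r).indicator fun s =>
    G s * (∏ j, (1 + s j) ^ N j) * ∏ j, s j ^ ((d j : ℝ) / 2 - 1)

lemma near_le {r : ℕ} {d : Fin r → ℕ} {h : Fin r → ℝ} (hh : ∀ j, 0 < h j) {G : (Fin r → ℝ) → ℝ}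
    (hG : HasMoments G) {q : (Fin r → ℝ) → ℝ} {k : ℕ}
    (hq : ∀ s ∈ posOrthant r, 0 ≤ q s ∧ q s ≤ ∏ j, (1 + s j) ^ k) (s : Fin r → ℝ) :
    ‖(nearSet h).indicator (fun s => (∏ j, capWeight (d j) (h j) (s j)) * (G s * q s)) s‖ ≤
      (∏ j, (sphArea (d j - 1) * 2 ^ d j)) * momentBound d G (fun _ => k) s := by
  have hD : 0 ≤ ∏ j, (sphArea (d j - 1) * 2 ^ d j) :=
    Finset.prod_nonneg fun j _ => mul_nonneg (sphArea_nonneg _) (by positivity)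
  have hm : 0 ≤ momentBound d G (fun _ => k) s := by
    refine Set.indicator_nonneg (fun s hs => ?_) s
    have hs' : ∀ j, 0 < s j := hs
    exact mul_nonneg (mul_nonneg (hG.nonneg s fun j => (hs' j).le)
      (Finset.prod_nonneg fun j _ => pow_nonneg (by linarith [hs' j]) _))
      (Finset.prod_nonneg fun j _ => Real.rpow_nonneg (hs' j).le _)
  by_cases hn : s ∈ nearSet h
  swap
  · rw [Set.indicator_of_notMem hn, norm_zero]; positivity
  rw [Set.indicator_of_mem hn]
  by_cases hs : ∀ j, 0 < s j ∧ h j ^ 2 * s j < 2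
  swap
  · rw [prod_capWeight_eq_zero d hh hs, zero_mul, norm_zero]; positivity
  have hsp : s ∈ posOrthant r := fun j => (hs j).1
  have hG0 : 0 ≤ G s := hG.nonneg s fun j => (hsp j).le
  have hw0 : 0 ≤ ∏ j, capWeight (d j) (h j) (s j) :=
    Finset.prod_nonneg fun j _ => capWeight_nonneg _ (hh j) _
  rw [Real.norm_of_nonneg (mul_nonneg hw0 (mul_nonneg hG0 (hq s hsp).1)), momentBound,
    Set.indicator_of_mem hsp]
  have h1 : ∏ j, capWeight (d j) (h j) (s j) ≤
      (∏ j, (sphArea (d j - 1) * 2 ^ d j)) * ∏ j, s j ^ ((d j : ℝ) / 2 - 1) := by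
    rw [← Finset.prod_mul_distrib]
    exact Finset.prod_le_prod (fun j _ => capWeight_nonneg _ (hh j) _)
      fun j _ => capWeight_le_of_le_one (hsp j) (hn j)
  calc _ ≤ ((∏ j, (sphArea (d j - 1) * 2 ^ d j)) * ∏ j, s j ^ ((d j : ℝ) / 2 - 1)) *
        (G s * ∏ j, (1 + s j) ^ k) := by
        refine mul_le_mul h1 (mul_le_mul_of_nonneg_left (hq s hsp).2 hG0)
          (mul_nonneg hG0 (hq s hsp).1) (hw0.trans h1)
    _ = _ := by ring

/-- Splits the integrand into a part carrying the kernel, dominated independently of h, and a part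
carrying the singularities, a sum of products of one-variable functions. The weight R = ∏ (1 +
s_j)^(d_j+2) supplies decay to the singular part and is paid for by higher moments of the kernel. -/
lemma far_le {r : ℕ} {d : Fin r → ℕ} (hd : ∀ j, 1 ≤ d j) {h : Fin r → ℝ} (hh : ∀ j, 0 < h j)
    (hh1 : ∀ j, h j ≤ 1) {G : (Fin r → ℝ) → ℝ} (hG : HasMoments G) {M : ℝ}
    (hM : ∀ s, (∀ j, 0 ≤ s j) → G s ≤ M) {q : (Fin r → ℝ) → ℝ} {k : ℕ}
    (hq : ∀ s ∈ posOrthant r, 0 ≤ q s ∧ q s ≤ ∏ j, (1 + s j) ^ k) (s : Fin r → ℝ) :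
    ‖(nearSet h)ᶜ.indicator (fun s => (∏ j, capWeight (d j) (h j) (s j)) * (G s * q s)) s‖ ≤
      (∏ j, (sphArea (d j - 1) * 2 ^ d j)) *
        ((nearSet h)ᶜ.indicator (fun s => M ^ 2 * momentBound d G (fun j => 3 * (k + 2 * (d j + 2))) s) s
          + farBound d h s) := by
  have hD : 0 ≤ ∏ j, (sphArea (d j - 1) * 2 ^ d j) :=
    Finset.prod_nonneg fun j _ => mul_nonneg (sphArea_nonneg _) (by positivity)
  have hfar : 0 ≤ farBound d h s := by
    refine Finset.sum_nonneg fun i _ => Finset.prod_nonneg fun j _ => ?_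
    have := antipodalBound_nonneg (hh j) (s j)
    have := halfLineBound_nonneg (d j) (s j)
    split_ifs <;> positivity
  have hm : 0 ≤ momentBound d G (fun j => 3 * (k + 2 * (d j + 2))) s := by
    refine Set.indicator_nonneg (fun s hs => ?_) s
    have hs' : ∀ j, 0 < s j := hs
    exact mul_nonneg (mul_nonneg (hG.nonneg s fun j => (hs' j).le)
      (Finset.prod_nonneg fun j _ => pow_nonneg (by linarith [hs' j]) _))
      (Finset.prod_nonneg fun j _ => Real.rpow_nonneg (hs' j).le _)
  by_cases hn : s ∈ (nearSet h)ᶜ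
  swap
  · rw [Set.indicator_of_notMem hn, Set.indicator_of_notMem hn, norm_zero, zero_add]; positivity
  rw [Set.indicator_of_mem hn, Set.indicator_of_mem hn]
  by_cases hs : ∀ j, 0 < s j ∧ h j ^ 2 * s j < 2
  swap
  · rw [prod_capWeight_eq_zero d hh hs, zero_mul, norm_zero]; positivity
  have hsp : ∀ j, 0 < s j := fun j => (hs j).1
  have hsp' : s ∈ posOrthant r := hsp
  have hG0 : 0 ≤ G s := hG.nonneg s fun j => (hsp j).le
  have hGM := hM s fun j => (hsp j).le
  have hw0 : 0 ≤ ∏ j, capWeight (d j) (h j) (s j) :=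
    Finset.prod_nonneg fun j _ => capWeight_nonneg _ (hh j) _
  rw [Real.norm_of_nonneg (mul_nonneg hw0 (mul_nonneg hG0 (hq s hsp').1)), momentBound,
    Set.indicator_of_mem hsp']
  set v : Fin r → ℝ := fun j => (2 - h j ^ 2 * s j) ^ (-(1 / 4) : ℝ) with hv
  have hv0 : ∀ j, 0 < v j := fun j => Real.rpow_pos_of_pos (by linarith [(hs j).2]) _
  set R : ℝ := ∏ j, (1 + s j) ^ (d j + 2) with hR
  have hR0 : 0 < R := Finset.prod_pos fun j _ => pow_pos (by linarith [hsp j]) _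
  set A : ℝ := ∏ j, s j ^ ((d j : ℝ) / 2 - 1) with hA
  have hA0 : 0 ≤ A := Finset.prod_nonneg fun j _ => Real.rpow_nonneg (hsp j).le _
  set T : ℝ := ∏ j, (1 + s j) ^ k with hT
  have hT0 : 0 ≤ T := Finset.prod_nonneg fun j _ => pow_nonneg (by linarith [hsp j]) _
  have hV0 : 0 ≤ ∏ j, v j := Finset.prod_nonneg fun j _ => (hv0 j).le
  have h1 : ∏ j, capWeight (d j) (h j) (s j) ≤
      (∏ j, (sphArea (d j - 1) * 2 ^ d j)) * (A * (∏ j, v j) ^ 2) := by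
    rw [← Finset.prod_pow, ← Finset.prod_mul_distrib, ← Finset.prod_mul_distrib]
    exact Finset.prod_le_prod (fun j _ => capWeight_nonneg _ (hh j) _)
      fun j _ => capWeight_le (hd j) (hsp j) (hs j).2
  -- `mul_sq_le_cube_add_cube` with a = G T R² and v = ∏ v_j / R, so that R cancels in a v².
  have h2 : G s * T * (∏ j, v j) ^ 2 ≤ (G s * T * R ^ 2) ^ 3 + ((∏ j, v j) / R) ^ 3 := by
    have := mul_sq_le_cube_add_cube (a := G s * T * R ^ 2) (v := (∏ j, v j) / R) (by positivity)
      (by positivity)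
    refine le_trans (le_of_eq ?_) this
    field_simp
  have h3 : A * (G s * T * R ^ 2) ^ 3 ≤
      M ^ 2 * (G s * (∏ j, (1 + s j) ^ (3 * (k + 2 * (d j + 2)))) * A) := by
    have e : ∏ j, (1 + s j) ^ (3 * (k + 2 * (d j + 2))) = (T * R ^ 2) ^ 3 := by
      rw [hT, hR, ← Finset.prod_pow, ← Finset.prod_mul_distrib, ← Finset.prod_pow]
      refine Finset.prod_congr rfl fun j _ => ?_
      ring
    rw [e]
    -- Boundedness reduces G³ to M² G, for which moments are available.
    have hg : G s ^ 2 ≤ M ^ 2 := pow_le_pow_left₀ hG0 hGM 2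
    calc A * (G s * T * R ^ 2) ^ 3 = G s ^ 2 * (G s * (T * R ^ 2) ^ 3 * A) := by ring
      _ ≤ _ := by gcongr
  have h4 : A * ((∏ j, v j) / R) ^ 3 ≤ farBound d h s := by
    have e : A * ((∏ j, v j) / R) ^ 3 =
        ∏ j, (s j ^ ((d j : ℝ) / 2 - 1) * v j ^ 3 / (1 + s j) ^ (3 * (d j + 2))) := by
      rw [hA, hR, div_pow, ← Finset.prod_pow, ← Finset.prod_pow, ← mul_div_assoc,
        ← Finset.prod_mul_distrib, ← Finset.prod_div_distrib]
      refine Finset.prod_congr rfl fun j _ => ?_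
      rw [← pow_mul, mul_comm 3]
    rw [e]
    -- Outside the near set some coordinate i is far; there the purely antipodal bound applies,
    -- which selects the summand i of `farBound`.
    obtain ⟨i, hi⟩ : ∃ i, 1 < h i ^ 2 * s i := by
      simpa [nearSet] using hn
    refine le_trans ?_ (Finset.single_le_sum (f := fun i => ∏ j, (if j = i then
      antipodalBound (h j) (s j) else halfLineBound (d j) (s j) + antipodalBound (h j) (s j)))
      (fun i _ => Finset.prod_nonneg fun j _ => ?_) (Finset.mem_univ i))
    · refine Finset.prod_le_prod (fun j _ => ?_) fun j _ => ?_
      · have := hsp j; have := hv0 j; positivity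
      · have hb := singular_le_bounds (hd j) (hh j) (hh1 j) (hsp j) (hs j).2
        split_ifs with hji
        · subst hji; exact hb.2 hi
        · exact hb.1
    · have := antipodalBound_nonneg (hh j) (s j)
      have := halfLineBound_nonneg (d j) (s j)
      split_ifs <;> positivity
  calc _ ≤ ((∏ j, (sphArea (d j - 1) * 2 ^ d j)) * (A * (∏ j, v j) ^ 2)) * (G s * T) := by
        refine mul_le_mul h1 (mul_le_mul_of_nonneg_left (hq s hsp').2 hG0)
          (mul_nonneg hG0 (hq s hsp').1) (hw0.trans h1)
    _ = (∏ j, (sphArea (d j - 1) * 2 ^ d j)) * (A * (G s * T * (∏ j, v j) ^ 2)) := by ring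
    _ ≤ (∏ j, (sphArea (d j - 1) * 2 ^ d j)) * (A * ((G s * T * R ^ 2) ^ 3 + ((∏ j, v j) / R) ^ 3)) := by
        gcongr
    _ ≤ _ := by
        gcongr
        rw [mul_add]
        exact add_le_add h3 h4

/-! ### Passage to the limit in the rescaled integrals -/

lemma integrable_momentBound {r : ℕ} {d : Fin r → ℕ} (hd : ∀ j, 1 ≤ d j) {G : (Fin r → ℝ) → ℝ}
    (hG : HasMoments G) (N : Fin r → ℕ) : Integrable (momentBound d G N) :=
  (integrable_indicator_iff (measurableSet_posOrthant r)).2 (hG.integrableOn_prod_pow d hd N)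

lemma tendsto_capWeight (d : ℕ) {h : ℕ → ℝ} (hpos : ∀ n, 0 < h n) (hlim : Tendsto h atTop (𝓝 0))
    (s : ℝ) : Tendsto (fun n => capWeight d (h n) s) atTop (𝓝 (limWeight d s)) := by
  by_cases hs : 0 < s
  · have h2 : Tendsto (fun n => h n ^ 2 * s) atTop (𝓝 0) := by
      simpa using (hlim.pow 2).mul_const s
    rw [limWeight, Set.indicator_of_mem (show s ∈ Set.Ioi 0 from hs)]
    have h3 : Tendsto (fun n => sphArea (d - 1) *
        (s ^ ((d : ℝ) / 2 - 1) * (2 - h n ^ 2 * s) ^ ((d : ℝ) / 2 - 1))) atTop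
        (𝓝 (sphArea (d - 1) * (s ^ ((d : ℝ) / 2 - 1) * 2 ^ ((d : ℝ) / 2 - 1)))) := by
      have h4 : Tendsto (fun n => 2 - h n ^ 2 * s) atTop (𝓝 2) := by simpa using h2.const_sub 2
      exact ((h4.rpow_const (Or.inl two_ne_zero)).const_mul _).const_mul _
    refine h3.congr' ?_
    filter_upwards [h2.eventually_lt_const two_pos] with n hn
    rw [capWeight, Set.indicator_of_mem ((mem_Ioo_two_div (hpos n)).2 ⟨hs, hn⟩)]
  · have h1 : limWeight d s = 0 := Set.indicator_of_notMem hs _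
    rw [h1]
    refine tendsto_const_nhds.congr fun n => ?_
    exact (Set.indicator_of_notMem (fun h => hs h.1) _).symm

lemma eventually_mem_nearSet {r : ℕ} {h : ℕ → Fin r → ℝ} (hlim : Tendsto h atTop (𝓝 0))
    (s : Fin r → ℝ) : ∀ᶠ n in atTop, s ∈ nearSet (h n) := by
  refine eventually_all.2 fun j => ?_
  have h2 : Tendsto (fun n => h n j ^ 2 * s j) atTop (𝓝 0) := by
    simpa using ((tendsto_pi_nhds.1 hlim j).pow 2).mul_const (s j)
  exact (h2.eventually_lt_const one_pos).mono fun n hn => hn.le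

lemma lam_eq_integral {r : ℕ} (d : Fin r → ℕ) (g : (Fin r → ℝ) → ℝ) :
    lam d g = ∫ s, (∏ j, limWeight (d j) (s j)) * g s := by
  rw [lam, ← integral_const_mul, ← integral_indicator (measurableSet_posOrthant r)]
  congr 1
  ext s
  by_cases hs : s ∈ posOrthant r
  · rw [Set.indicator_of_mem hs]
    have : ∀ j, limWeight (d j) (s j) = sphArea (d j - 1) *
        (s j ^ ((d j : ℝ) / 2 - 1) * 2 ^ ((d j : ℝ) / 2 - 1)) := fun j =>
      Set.indicator_of_mem (show s j ∈ Set.Ioi 0 from hs j) _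
    simp_rw [this]
    rw [Finset.prod_mul_distrib (f := fun j => sphArea (d j - 1))]
    ring
  · rw [Set.indicator_of_notMem hs]
    obtain ⟨j, hj⟩ : ∃ j, ¬ 0 < s j := by simpa [posOrthant] using hs
    rw [Finset.prod_eq_zero (Finset.mem_univ j) (Set.indicator_of_notMem hj _), zero_mul]

/-- Asymptotics of the integrals of a rescaled kernel over the polysphere. -/
lemma tendsto_integral_capVec {r : ℕ} {d : Fin r → ℕ} (hd : ∀ j, 1 ≤ d j) {h : ℕ → Fin r → ℝ}
    (hpos : ∀ n j, 0 < h n j) (hlim : Tendsto h atTop (𝓝 0)) {G : (Fin r → ℝ) → ℝ}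
    (hG : HasMoments G) {q : (Fin r → ℝ) → ℝ} (hqm : Measurable q) {k : ℕ}
    (hq : ∀ s ∈ posOrthant r, 0 ≤ q s ∧ q s ≤ ∏ j, (1 + s j) ^ k) (x : Polysphere d) :
    Tendsto (fun n => (rho d (h n))⁻¹ *
      ∫ y, G (capVec (h n) x y) * q (capVec (h n) x y) ∂(polyMeasure d)) atTop
      (𝓝 (lam d fun s => G s * q s)) := by
  obtain ⟨M, hM⟩ := hG.bounded
  have hj : ∀ j, Tendsto (fun n => h n j) atTop (𝓝 0) := fun j => tendsto_pi_nhds.1 hlim j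
  let F : ℕ → (Fin r → ℝ) → ℝ := fun n s => (∏ j, capWeight (d j) (h n j) (s j)) * (G s * q s)
  have hGm := hG.measurable
  have hFm : ∀ n, Measurable (F n) := fun n => by fun_prop
  have hI : ∀ n, (rho d (h n))⁻¹ *
      ∫ y, G (capVec (h n) x y) * q (capVec (h n) x y) ∂(polyMeasure d) = ∫ s, F n s := by
    intro n
    rw [integral_capVec hd (hpos n) x (G := fun s => G s * q s) (by fun_prop),
      ← integral_const_mul]
    congr 1
    ext s
    have hr : rho d (h n) ≠ 0 := (Finset.prod_pos fun j _ => pow_pos (hpos n j) _).ne'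
    simp_rw [capDensity_eq, Finset.prod_mul_distrib]
    change (rho d (h n))⁻¹ * (rho d (h n) * _ * _) = _
    field_simp
    simp only [F]
    ring
  have hev1 : ∀ᶠ n in atTop, ∀ j, h n j ≤ 1 := eventually_all.2 fun j =>
    ((hj j).eventually_lt_const one_pos).mono fun n hn => hn.le
  set D := ∏ j, (sphArea (d j - 1) * 2 ^ d j) with hDdef
  have hb1 := (integrable_momentBound hd hG fun _ => k).const_mul D
  have hb2 := (integrable_momentBound hd hG fun j => 3 * (k + 2 * (d j + 2))).const_mul (M ^ 2)
  have near_int : ∀ n, Integrable ((nearSet (h n)).indicator (F n)) := fun n =>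
    hb1.mono' ((hFm n).indicator (measurableSet_nearSet _)).aestronglyMeasurable
      (ae_of_all _ (near_le (hpos n) hG hq))
  have far_bint : ∀ n, Integrable fun s => D * ((nearSet (h n))ᶜ.indicator
      (fun s => M ^ 2 * momentBound d G (fun j => 3 * (k + 2 * (d j + 2))) s) s +
        farBound d (h n) s) := fun n =>
    ((hb2.indicator (measurableSet_nearSet _).compl).add (integral_farBound hd (hpos n)).1).const_mul D
  have far_int : ∀ n, (∀ j, h n j ≤ 1) → Integrable ((nearSet (h n))ᶜ.indicator (F n)) := fun n hn =>
    (far_bint n).mono' ((hFm n).indicator (measurableSet_nearSet _).compl).aestronglyMeasurable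
      (ae_of_all _ (far_le hd (hpos n) hn hG hM hq))
  have near_lim : Tendsto (fun n => ∫ s, (nearSet (h n)).indicator (F n) s) atTop
      (𝓝 (lam d fun s => G s * q s)) := by
    rw [lam_eq_integral]
    refine tendsto_integral_of_dominated_convergence _
      (fun n => (near_int n).aestronglyMeasurable) hb1
      (fun n => ae_of_all _ (near_le (hpos n) hG hq)) (ae_of_all _ fun s => ?_)
    have h1 : Tendsto (fun n => F n s) atTop
        (𝓝 ((∏ j, limWeight (d j) (s j)) * (G s * q s))) :=
      (tendsto_finsetProd _ fun j _ =>
        tendsto_capWeight (d j) (fun n => hpos n j) (hj j) (s j)).mul_const _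
    refine h1.congr' ?_
    filter_upwards [eventually_mem_nearSet hlim s] with n hn
    rw [Set.indicator_of_mem hn]
  -- Each fixed s is eventually near, so the moment part vanishes in the limit by dominated
  -- convergence; the singular part vanishes by `tendsto_integral_farBound`.
  have far_lim : Tendsto (fun n => ∫ s, (nearSet (h n))ᶜ.indicator (F n) s) atTop (𝓝 0) := by
    have h1 : Tendsto (fun n => ∫ s, (nearSet (h n))ᶜ.indicator
      (fun s => M ^ 2 * momentBound d G (fun j => 3 * (k + 2 * (d j + 2))) s) s) atTop (𝓝 0) := by
      have : (0 : ℝ) = ∫ s : Fin r → ℝ, (0 : ℝ) := by simp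
      rw [this]
      refine tendsto_integral_of_dominated_convergence _
        (fun n => (hb2.indicator (measurableSet_nearSet _).compl).aestronglyMeasurable) hb2.norm
        (fun n => ae_of_all _ fun s => norm_indicator_le_norm_self _ _) (ae_of_all _ fun s => ?_)
      refine tendsto_const_nhds.congr' ?_
      filter_upwards [eventually_mem_nearSet hlim s] with n hn
      rw [Set.indicator_of_notMem (Set.notMem_compl_iff.2 hn)]
    have h2 : Tendsto (fun n => ∫ s, D * ((nearSet (h n))ᶜ.indicator
      (fun s => M ^ 2 * momentBound d G (fun j => 3 * (k + 2 * (d j + 2))) s) s +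
        farBound d (h n) s)) atTop (𝓝 0) := by
      have h3 := (h1.add (tendsto_integral_farBound hd hpos hlim)).const_mul D
      simp only [add_zero, mul_zero] at h3
      refine h3.congr fun n => ?_
      rw [integral_const_mul, integral_add (hb2.indicator (measurableSet_nearSet _).compl)
        (integral_farBound hd (hpos n)).1]
    refine squeeze_zero_norm' ?_ h2
    filter_upwards [hev1] with n hn
    exact norm_integral_le_of_norm_le (far_bint n) (ae_of_all _ (far_le hd (hpos n) hn hG hM hq))
  have := near_lim.add far_lim
  rw [add_zero] at this
  refine this.congr' ?_
  filter_upwards [hev1] with n hn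
  rw [hI n, ← integral_add (near_int n) (far_int n hn)]
  congr 1
  ext s
  exact Set.indicator_self_add_compl_apply _ _ _

/-! ### Scaled moments and the normalizing constant -/

/-- The integral `ρ(h)⁻¹ ∫ G(S) S_j^p dσ`, where `S` is the vector of scaled distances to `x`. -/
def capMoment {r : ℕ} {d : Fin r → ℕ} (G : (Fin r → ℝ) → ℝ) (h : Fin r → ℝ) (x : Polysphere d)
    (j : Fin r) (p : ℕ) : ℝ :=
  (rho d h)⁻¹ * ∫ y, G (capVec h x y) * capVec h x y j ^ p ∂(polyMeasure d)

lemma tendsto_capMoment {r : ℕ} {d : Fin r → ℕ} (hd : ∀ j, 1 ≤ d j) {h : ℕ → Fin r → ℝ}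
    (hpos : ∀ n j, 0 < h n j) (hlim : Tendsto h atTop (𝓝 0)) {G : (Fin r → ℝ) → ℝ}
    (hG : HasMoments G) (x : Polysphere d) (j : Fin r) (p : ℕ) :
    Tendsto (fun n => capMoment G (h n) x j p) atTop (𝓝 (lam d fun s => G s * s j ^ p)) := by
  refine tendsto_integral_capVec hd hpos hlim hG (q := fun s => s j ^ p) (k := p) (by fun_prop)
    (fun s hs => ⟨pow_nonneg (hs j).le _, ?_⟩) x
  calc s j ^ p ≤ (1 + s j) ^ p := pow_le_pow_left₀ (hs j).le (by linarith) p
    _ ≤ ∏ i, (1 + s i) ^ p := by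
      have h1 : ∀ i, 1 ≤ (1 + s i) ^ p := fun i => one_le_pow₀ (by linarith [hs i])
      rw [← Finset.mul_prod_erase _ _ (Finset.mem_univ j)]
      refine le_mul_of_one_le_right (zero_le_one.trans (h1 j)) ?_
      exact Finset.prod_induction _ (fun t => 1 ≤ t) (fun a b => one_le_mul_of_one_le_of_one_le)
        le_rfl fun i _ => h1 i

lemma sphArea_pos (k : ℕ) : 0 < sphArea k := by
  rw [sphArea, sphMeasure, Measure.toSphere_real_apply_univ]
  have : 0 < (volume : Measure (EuclideanSpace ℝ (Fin (k + 1)))).real (Metric.ball 0 1) :=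
    ENNReal.toReal_pos (Metric.isOpen_ball.measure_pos _ ⟨0, by simp⟩).ne' measure_ball_lt_top.ne
  have h2 : 0 < Module.finrank ℝ (EuclideanSpace ℝ (Fin (k + 1))) := by simp
  positivity

lemma lam_pos {r : ℕ} {d : Fin r → ℕ} (hd : ∀ j, 1 ≤ d j) {L : (Fin r → ℝ) → ℝ}
    (hL : IsKernel L) : 0 < lam d L := by
  rw [lam]
  refine mul_pos (Finset.prod_pos fun j _ => sphArea_pos _) ?_
  have h := hL.integral_pos 1 (Or.inl rfl) d hd
  simp_rw [pow_one] at h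
  simp_rw [Finset.prod_mul_distrib, ← mul_assoc]
  rw [integral_mul_const]
  exact mul_pos h (Finset.prod_pos fun j _ => by positivity)

lemma rho_pos {r : ℕ} (d : Fin r → ℕ) {h : Fin r → ℝ} (hh : ∀ j, 0 < h j) : 0 < rho d h :=
  Finset.prod_pos fun j _ => pow_pos (hh j) _

lemma rawKernel_eq {r : ℕ} {d : Fin r → ℕ} (L : (Fin r → ℝ) → ℝ) (h : Fin r → ℝ)
    (x y : Polysphere d) : rawKernel L h x y = L (capVec h x y) := rfl

lemma capVec_comm {r : ℕ} {d : Fin r → ℕ} (h : Fin r → ℝ) (x y : Polysphere d) :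
    capVec h x y = capVec h y x := by
  ext j; simp only [capVec, real_inner_comm]

/-- The normalizing constant does not depend on the centre. -/
lemma normConst_eq {r : ℕ} {d : Fin r → ℕ} (hd : ∀ j, 1 ≤ d j) {h : Fin r → ℝ}
    (hh : ∀ j, 0 < h j) {L : (Fin r → ℝ) → ℝ} (hL : Measurable L) (x y : Polysphere d) :
    normConst L h y = (∫ z, L (capVec h x z) ∂(polyMeasure d))⁻¹ := by
  rw [normConst]
  simp_rw [rawKernel_eq, fun z => capVec_comm h z y]
  rw [integral_capVec hd hh y hL, integral_capVec hd hh x hL]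

lemma capVec_nonneg {r : ℕ} {d : Fin r → ℕ} (h : Fin r → ℝ) (x y : Polysphere d) (j : Fin r) :
    0 ≤ capVec h x y j := by
  have := real_inner_le_norm (x j : EuclideanSpace ℝ (Fin (d j + 1))) (y j)
  rw [norm_eq_of_mem_sphere, norm_eq_of_mem_sphere, one_mul] at this
  exact div_nonneg (by linarith) (sq_nonneg _)

/-! ### Symmetry about the centre x -/

/-- The action of a family of linear isometries on the polysphere. -/
def polyMap {r : ℕ} {d : Fin r → ℕ}
    (φ : ∀ j, EuclideanSpace ℝ (Fin (d j + 1)) ≃ₗᵢ[ℝ] EuclideanSpace ℝ (Fin (d j + 1)))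
    (y : Polysphere d) : Polysphere d :=
  fun j => sphMap (φ j) (y j)

lemma measurePreserving_polyMap {r : ℕ} {d : Fin r → ℕ}
    (φ : ∀ j, EuclideanSpace ℝ (Fin (d j + 1)) ≃ₗᵢ[ℝ] EuclideanSpace ℝ (Fin (d j + 1))) :
    MeasurePreserving (polyMap φ) (polyMeasure d) (polyMeasure d) :=
  measurePreserving_pi _ _ fun j => measurePreserving_sphMap (φ j)

lemma capVec_polyMap {r : ℕ} {d : Fin r → ℕ}
    {φ : ∀ j, EuclideanSpace ℝ (Fin (d j + 1)) ≃ₗᵢ[ℝ] EuclideanSpace ℝ (Fin (d j + 1))}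
    {x : Polysphere d} (hφ : ∀ j, φ j (x j) = x j) (h : Fin r → ℝ) (y : Polysphere d) :
    capVec h x (polyMap φ y) = capVec h x y := by
  ext j
  have : ⟪(x j : EuclideanSpace ℝ (Fin (d j + 1))), φ j (y j)⟫ =
      ⟪(x j : EuclideanSpace ℝ (Fin (d j + 1))), (y j : EuclideanSpace ℝ (Fin (d j + 1)))⟫ := by
    conv_lhs => rw [← hφ j]
    rw [(φ j).inner_map_map]
  simp only [capVec, polyMap, sphMap, this]

/-- Isometries fixing each x_j preserve the measure and all distances to x, so they may be applied
to F alone. All the moment identities below come from choosing reflections here. -/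
lemma integral_polyMap {r : ℕ} {d : Fin r → ℕ}
    {φ : ∀ j, EuclideanSpace ℝ (Fin (d j + 1)) ≃ₗᵢ[ℝ] EuclideanSpace ℝ (Fin (d j + 1))}
    {x : Polysphere d} (hφ : ∀ j, φ j (x j) = x j) (h : Fin r → ℝ) {G : (Fin r → ℝ) → ℝ}
    (hG : Measurable G) {F : Polysphere d → ℝ} (hF : Measurable F) :
    ∫ y, G (capVec h x y) * F (polyMap φ y) ∂(polyMeasure d) =
      ∫ y, G (capVec h x y) * F y ∂(polyMeasure d) := by
  have hm := measurable_capVec h x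
  have h1 := integral_map (μ := polyMeasure d) (measurePreserving_polyMap φ).measurable.aemeasurable
    (f := fun y => G (capVec h x y) * F y) (by fun_prop)
  rw [(measurePreserving_polyMap φ).map_eq] at h1
  rw [h1]
  simp_rw [capVec_polyMap hφ]

lemma HasMoments.integrable_mul {r : ℕ} {d : Fin r → ℕ} {G : (Fin r → ℝ) → ℝ} (hG : HasMoments G)
    (h : Fin r → ℝ) (x : Polysphere d) {F : Polysphere d → ℝ} (hF : Continuous F) :
    Integrable (fun y => G (capVec h x y) * F y) (polyMeasure d) := by
  have hm := measurable_capVec h x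
  have hGm := hG.measurable
  obtain ⟨M, hM⟩ := hG.bounded
  obtain ⟨C, hC⟩ := isCompact_univ.exists_bound_of_continuousOn hF.continuousOn
  have hFm := hF.measurable
  refine Integrable.of_bound (C := M * C)
    (Measurable.aestronglyMeasurable (by fun_prop)) (ae_of_all _ fun y => ?_)
  have h0 := hG.nonneg _ (capVec_nonneg h x y)
  rw [norm_mul, Real.norm_of_nonneg h0]
  exact mul_le_mul (hM _ (capVec_nonneg h x y)) (hC y trivial) (norm_nonneg _)
    (h0.trans (hM _ (capVec_nonneg h x y)))

lemma exists_orthonormalBasis_zero {k : ℕ} (x : Sph k) :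
    ∃ b : OrthonormalBasis (Fin (k + 1)) ℝ (EuclideanSpace ℝ (Fin (k + 1))), b 0 = x := by
  obtain ⟨b, hb⟩ : ∃ b : OrthonormalBasis (Fin (k + 1)) ℝ (EuclideanSpace ℝ (Fin (k + 1))),
      ∀ i ∈ ({0} : Set (Fin (k + 1))), b i = x := by
    refine Orthonormal.exists_orthonormalBasis_extension_of_card_eq
      (v := fun _ => (x : EuclideanSpace ℝ (Fin (k + 1)))) (by simp) ?_
    constructor
    · intro i; simp [Set.domRestrict]
    · intro i j hij; exact absurd (Subsingleton.elim i j) hij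
  exact ⟨b, hb 0 rfl⟩

/-- Orthonormal bases of the factors, each starting with the given point of the sphere. -/
structure AdaptedBasis {r : ℕ} {d : Fin r → ℕ} (x : Polysphere d) where
  basis : ∀ j, OrthonormalBasis (Fin (d j + 1)) ℝ (EuclideanSpace ℝ (Fin (d j + 1)))
  basis_zero : ∀ j, basis j 0 = x j

namespace AdaptedBasis

variable {r : ℕ} {d : Fin r → ℕ} {x : Polysphere d}

/-- The coordinate of index `i` of the tangential part of `y`. -/
def coord (b : AdaptedBasis x) (i : (j : Fin r) × Fin (d j + 1)) (y : Polysphere d) : ℝ :=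
  if i.2 = 0 then 0 else ⟪b.basis i.1 i.2, (y i.1 : EuclideanSpace ℝ (Fin (d i.1 + 1)))⟫

@[fun_prop]
lemma continuous_coord (b : AdaptedBasis x) (i : (j : Fin r) × Fin (d j + 1)) :
    Continuous (b.coord i) := by
  unfold coord
  split_ifs <;> fun_prop

/-- The reflection of the factor `j` in the hyperplane orthogonal to `u`. -/
def reflectAt {j : Fin r} (u : EuclideanSpace ℝ (Fin (d j + 1))) (i : Fin r) :
    EuclideanSpace ℝ (Fin (d i + 1)) ≃ₗᵢ[ℝ] EuclideanSpace ℝ (Fin (d i + 1)) :=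
  if h : i = j then (ℝ ∙ (h ▸ u))ᗮ.reflection else LinearIsometryEquiv.refl ℝ _

lemma reflectAt_self {j : Fin r} (u : EuclideanSpace ℝ (Fin (d j + 1))) :
    reflectAt u j = (ℝ ∙ u)ᗮ.reflection := by
  simp [reflectAt]

lemma reflectAt_of_ne {i j : Fin r} (h : i ≠ j) (u : EuclideanSpace ℝ (Fin (d j + 1))) :
    reflectAt u i = LinearIsometryEquiv.refl ℝ _ := by
  simp [reflectAt, h]

lemma reflectAt_apply_of_orthogonal {j : Fin r} {u : EuclideanSpace ℝ (Fin (d j + 1))}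
    (hu : ⟪u, (x j : EuclideanSpace ℝ (Fin (d j + 1)))⟫ = 0) (i : Fin r) :
    reflectAt u i (x i) = x i := by
  by_cases h : i = j
  · subst h
    rw [reflectAt_self]
    exact Submodule.reflection_mem_subspace_eq_self (Submodule.mem_orthogonal_singleton_iff_inner_right.2 hu)
  · rw [reflectAt_of_ne h]; rfl

lemma inner_reflection {E : Type*} [NormedAddCommGroup E] [InnerProductSpace ℝ E]
    (K : Submodule ℝ E) [K.HasOrthogonalProjection] (v y : E) :
    ⟪v, K.reflection y⟫ = ⟪K.reflection v, y⟫ := by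
  conv_lhs => rw [← Submodule.reflection_reflection K v]
  rw [LinearIsometryEquiv.inner_map_map]

lemma coord_flip_self (b : AdaptedBasis x) (i : (j : Fin r) × Fin (d j + 1)) (y : Polysphere d) :
    b.coord i (polyMap (reflectAt (b.basis i.1 i.2)) y) = -b.coord i y := by
  unfold coord
  split_ifs
  · simp
  · simp only [polyMap, sphMap, reflectAt_self]
    rw [inner_reflection, Submodule.reflection_orthogonalComplement_singleton_eq_neg, inner_neg_left]

lemma coord_flip_of_ne (b : AdaptedBasis x) {i i' : (j : Fin r) × Fin (d j + 1)} (h : i' ≠ i)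
    (y : Polysphere d) :
    b.coord i' (polyMap (reflectAt (b.basis i.1 i.2)) y) = b.coord i' y := by
  obtain ⟨j, a⟩ := i
  obtain ⟨j', a'⟩ := i'
  unfold coord
  split_ifs
  · rfl
  · by_cases hj : j' = j
    · subst hj
      simp only [polyMap, sphMap, reflectAt_self]
      rw [inner_reflection, Submodule.reflection_mem_subspace_eq_self]
      refine Submodule.mem_orthogonal_singleton_iff_inner_right.2 ?_
      exact (b.basis j').orthonormal.2 fun h' => h (by rw [h'])
    · simp only [polyMap, sphMap, reflectAt_of_ne hj]
      rfl

/-- The reflection in the hyperplane orthogonal to the difference of two unit vectors exchanges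
them. -/
lemma coord_swap (b : AdaptedBasis x) {j : Fin r} {a c : Fin (d j + 1)} (ha : a ≠ 0) (hc : c ≠ 0)
    (y : Polysphere d) :
    b.coord ⟨j, a⟩ (polyMap (reflectAt (b.basis j a - b.basis j c)) y) = b.coord ⟨j, c⟩ y := by
  simp only [coord, ha, hc, if_false, polyMap, sphMap, reflectAt_self]
  rw [inner_reflection, Submodule.reflection_sub]
  rw [(b.basis j).orthonormal.1, (b.basis j).orthonormal.1]

lemma inner_basis_zero (b : AdaptedBasis x) {j : Fin r} {a : Fin (d j + 1)} (ha : a ≠ 0) :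
    ⟪b.basis j a, (x j : EuclideanSpace ℝ (Fin (d j + 1)))⟫ = 0 := by
  rw [← b.basis_zero]
  exact (b.basis j).orthonormal.2 ha

variable {G : (Fin r → ℝ) → ℝ}

lemma integral_coord (b : AdaptedBasis x) (hG : Measurable G) (h : Fin r → ℝ)
    (i : (j : Fin r) × Fin (d j + 1)) :
    ∫ y, G (capVec h x y) * b.coord i y ∂(polyMeasure d) = 0 := by
  by_cases hi : i.2 = 0
  · simp [coord, hi]
  have h1 := integral_polyMap (x := x) (reflectAt_apply_of_orthogonal (b.inner_basis_zero hi)) h hG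
    (b.continuous_coord i).measurable
  simp_rw [coord_flip_self, mul_neg, integral_neg] at h1
  linarith

/-- Reflecting in the direction i changes the sign of one factor only, so the integral equals its
own negative. -/
lemma integral_coord_mul_coord_of_ne (b : AdaptedBasis x) (hG : Measurable G) (h : Fin r → ℝ)
    {i i' : (j : Fin r) × Fin (d j + 1)} (hne : i ≠ i') :
    ∫ y, G (capVec h x y) * (b.coord i y * b.coord i' y) ∂(polyMeasure d) = 0 := by
  by_cases hi : i.2 = 0
  · simp [coord, hi]
  have h1 := integral_polyMap (x := x) (reflectAt_apply_of_orthogonal (b.inner_basis_zero hi)) h hG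
    (F := fun y => b.coord i y * b.coord i' y)
    ((b.continuous_coord i).mul (b.continuous_coord i')).measurable
  simp_rw [coord_flip_self, coord_flip_of_ne b hne.symm, neg_mul, mul_neg, integral_neg] at h1
  linarith

lemma integral_coord_sq_eq (b : AdaptedBasis x) (hG : Measurable G) (h : Fin r → ℝ)
    {j : Fin r} {a c : Fin (d j + 1)} (ha : a ≠ 0) (hc : c ≠ 0) :
    ∫ y, G (capVec h x y) * b.coord ⟨j, a⟩ y ^ 2 ∂(polyMeasure d) =
      ∫ y, G (capVec h x y) * b.coord ⟨j, c⟩ y ^ 2 ∂(polyMeasure d) := by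
  have h1 := integral_polyMap (x := x) (φ := reflectAt (b.basis j a - b.basis j c))
    (reflectAt_apply_of_orthogonal (by
      rw [inner_sub_left, b.inner_basis_zero ha, b.inner_basis_zero hc, sub_zero])) h hG
    (F := fun y => b.coord ⟨j, a⟩ y ^ 2)
    ((b.continuous_coord _).pow 2).measurable
  simp_rw [coord_swap b ha hc] at h1
  exact h1.symm

lemma sum_coord_sq (b : AdaptedBasis x) (j : Fin r) (y : Polysphere d) :
    ∑ a : Fin (d j), b.coord ⟨j, a.succ⟩ y ^ 2 =
      1 - ⟪(x j : EuclideanSpace ℝ (Fin (d j + 1))), (y j : EuclideanSpace ℝ (Fin (d j + 1)))⟫ ^ 2 := by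
  have h1 := (b.basis j).sum_inner_mul_inner (y j : EuclideanSpace ℝ (Fin (d j + 1))) (y j)
  rw [real_inner_self_eq_norm_sq, norm_eq_of_mem_sphere, Fin.sum_univ_succ, b.basis_zero] at h1
  have h2 : ∀ a : Fin (d j), b.coord ⟨j, a.succ⟩ y ^ 2 =
      ⟪(y j : EuclideanSpace ℝ (Fin (d j + 1))), b.basis j a.succ⟫ *
        ⟪b.basis j a.succ, (y j : EuclideanSpace ℝ (Fin (d j + 1)))⟫ := by
    intro a
    simp only [coord, Fin.succ_ne_zero, if_false]
    rw [real_inner_comm (y j : EuclideanSpace ℝ (Fin (d j + 1))) (b.basis j a.succ)]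
    ring
  simp_rw [h2]
  rw [real_inner_comm (x j : EuclideanSpace ℝ (Fin (d j + 1))) (y j)] at h1
  linarith

/-- The d_j tangential coordinates have equal second moments, and by Parseval their squares add up
to 1 - (x_j'y_j)². -/
lemma integral_coord_sq (b : AdaptedBasis x) (hG : HasMoments G) (h : Fin r → ℝ) {j : Fin r}
    (hd : 1 ≤ d j) (a : Fin (d j)) :
    ∫ y, G (capVec h x y) * b.coord ⟨j, a.succ⟩ y ^ 2 ∂(polyMeasure d) = (d j : ℝ)⁻¹ *
      ∫ y, G (capVec h x y) * (1 - ⟪(x j : EuclideanSpace ℝ (Fin (d j + 1))),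
        (y j : EuclideanSpace ℝ (Fin (d j + 1)))⟫ ^ 2) ∂(polyMeasure d) := by
  simp_rw [← b.sum_coord_sq j, Finset.mul_sum]
  rw [integral_finsetSum _ fun c _ => hG.integrable_mul h x
    (F := fun y => b.coord ⟨j, c.succ⟩ y ^ 2) (by fun_prop)]
  simp_rw [fun c : Fin (d j) => b.integral_coord_sq_eq hG.measurable h (Fin.succ_ne_zero c) (Fin.succ_ne_zero a)]
  rw [Finset.sum_const, Finset.card_univ, Fintype.card_fin, nsmul_eq_mul]
  have : (d j : ℝ) ≠ 0 := by positivity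
  field_simp

/-- The vector of the ambient space given by the basis vector of index `i`. -/
def vec (b : AdaptedBasis x) (i : (j : Fin r) × Fin (d j + 1)) : Ambient d :=
  Pi.single i.1 (b.basis i.1 i.2)

/-- Coordinates of index 0, the radial ones, are zero by definition; the sum over all indices is
therefore the projection of y_j off x_j. -/
lemma sum_coord_smul_vec (b : AdaptedBasis x) (y : Polysphere d) (j : Fin r) :
    (∑ i, b.coord i y • b.vec i) j = (y j : EuclideanSpace ℝ (Fin (d j + 1))) -
      ⟪(x j : EuclideanSpace ℝ (Fin (d j + 1))), (y j : EuclideanSpace ℝ (Fin (d j + 1)))⟫ •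
        (x j : EuclideanSpace ℝ (Fin (d j + 1))) := by
  rw [Fintype.sum_sigma, Finset.sum_apply, Finset.sum_eq_single j]
  · have hv : ∀ a, (b.coord ⟨j, a⟩ y • b.vec ⟨j, a⟩) j = b.coord ⟨j, a⟩ y • b.basis j a := fun a => by
      rw [Pi.smul_apply, vec, Pi.single_eq_same]
    rw [Finset.sum_apply]
    simp_rw [hv]
    rw [Fin.sum_univ_succ]
    have hy := (b.basis j).sum_repr' (y j : EuclideanSpace ℝ (Fin (d j + 1)))
    rw [Fin.sum_univ_succ, b.basis_zero] at hy
    have h0 : b.coord ⟨j, 0⟩ y = 0 := if_pos rfl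
    have hs : ∀ a : Fin (d j), b.coord ⟨j, a.succ⟩ y = ⟪b.basis j a.succ, (y j : EuclideanSpace ℝ (Fin (d j + 1)))⟫ :=
      fun a => if_neg (Fin.succ_ne_zero a)
    rw [h0, zero_smul, zero_add]
    simp_rw [hs]
    exact eq_sub_of_add_eq' hy
  · intro k _ hk
    rw [Finset.sum_apply]
    refine Finset.sum_eq_zero fun a _ => ?_
    rw [Pi.smul_apply, vec, Pi.single_eq_of_ne hk.symm, smul_zero]
  · simp

/-- Integral of a quadratic form in the tangential part of `y` against a function of the distances
to `x`. -/
lemma integral_bilin (b : AdaptedBasis x) (hd : ∀ j, 1 ≤ d j) (hG : HasMoments G) (h : Fin r → ℝ)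
    (B : Ambient d →L[ℝ] Ambient d →L[ℝ] ℝ) :
    ∫ y, G (capVec h x y) * B (∑ i, b.coord i y • b.vec i) (∑ i, b.coord i y • b.vec i)
      ∂(polyMeasure d) =
    ∑ j, (∑ a : Fin (d j), B (b.vec ⟨j, a.succ⟩) (b.vec ⟨j, a.succ⟩)) * ((d j : ℝ)⁻¹ *
      ∫ y, G (capVec h x y) * (1 - ⟪(x j : EuclideanSpace ℝ (Fin (d j + 1))),
        (y j : EuclideanSpace ℝ (Fin (d j + 1)))⟫ ^ 2) ∂(polyMeasure d)) := by
  have h1 : ∀ y, G (capVec h x y) * B (∑ i, b.coord i y • b.vec i) (∑ i, b.coord i y • b.vec i) =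
      ∑ i, ∑ i', B (b.vec i) (b.vec i') * (G (capVec h x y) * (b.coord i y * b.coord i' y)) := by
    intro y
    simp only [map_sum, map_smul, _root_.sum_apply, _root_.smul_apply,
      smul_eq_mul, Finset.mul_sum]
    rw [Finset.sum_comm]
    refine Finset.sum_congr rfl fun i _ => Finset.sum_congr rfl fun i' _ => ?_
    ring
  simp_rw [h1]
  have hint : ∀ i i', Integrable (fun y => B (b.vec i) (b.vec i') *
      (G (capVec h x y) * (b.coord i y * b.coord i' y))) (polyMeasure d) := fun i i' =>
    (hG.integrable_mul h x ((b.continuous_coord i).mul (b.continuous_coord i'))).const_mul _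
  rw [integral_finsetSum _ fun i _ => integrable_finsetSum _ fun i' _ => hint i i']
  simp_rw [fun i => integral_finsetSum Finset.univ fun i' (_ : i' ∈ Finset.univ) => hint i i',
    integral_const_mul]
  have h2 : ∀ i, ∑ i', B (b.vec i) (b.vec i') *
      ∫ y, G (capVec h x y) * (b.coord i y * b.coord i' y) ∂(polyMeasure d) =
      B (b.vec i) (b.vec i) * ∫ y, G (capVec h x y) * b.coord i y ^ 2 ∂(polyMeasure d) := by
    intro i
    rw [Finset.sum_eq_single i]
    · simp_rw [sq]
    · intro i' _ hne
      rw [b.integral_coord_mul_coord_of_ne hG.measurable h hne.symm, mul_zero]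
    · simp
  simp_rw [h2]
  rw [Fintype.sum_sigma]
  refine Finset.sum_congr rfl fun j _ => ?_
  rw [Fin.sum_univ_succ, Finset.sum_mul]
  have h3 : ∫ y, G (capVec h x y) * b.coord ⟨j, 0⟩ y ^ 2 ∂(polyMeasure d) = 0 := by simp [coord]
  rw [h3, mul_zero, zero_add]
  refine Finset.sum_congr rfl fun a _ => ?_
  rw [b.integral_coord_sq hG h (hd j)]

lemma integral_linear (b : AdaptedBasis x) (hG : HasMoments G) (h : Fin r → ℝ)
    (l : Ambient d →L[ℝ] ℝ) :
    ∫ y, G (capVec h x y) * l (∑ i, b.coord i y • b.vec i) ∂(polyMeasure d) = 0 := by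
  have h1 : ∀ y, G (capVec h x y) * l (∑ i, b.coord i y • b.vec i) =
      ∑ i, l (b.vec i) * (G (capVec h x y) * b.coord i y) := by
    intro y
    simp only [map_sum, map_smul, smul_eq_mul, Finset.mul_sum]
    refine Finset.sum_congr rfl fun i _ => ?_
    ring
  simp_rw [h1]
  rw [integral_finsetSum _ fun i _ => (hG.integrable_mul h x (b.continuous_coord i)).const_mul _]
  simp_rw [integral_const_mul, b.integral_coord hG.measurable, mul_zero, Finset.sum_const_zero]

end AdaptedBasis

/-! ### Traces in orthonormal bases and second-order Taylor expansion -/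

lemma sum_bilin_orthonormalBasis {E : Type*} [NormedAddCommGroup E] [InnerProductSpace ℝ E]
    {ι : Type*} [Fintype ι] (b e : OrthonormalBasis ι ℝ E) (B : E →ₗ[ℝ] E →ₗ[ℝ] ℝ) :
    ∑ a, B (b a) (b a) = ∑ i, B (e i) (e i) := by
  classical
  have h1 : ∀ a, B (b a) (b a) = ∑ i, ∑ k, (⟪e i, b a⟫ * ⟪b a, e k⟫) * B (e i) (e k) := by
    intro a
    conv_lhs => rw [← e.sum_repr' (b a)]
    simp only [map_sum, map_smul, LinearMap.sum_apply, LinearMap.smul_apply, smul_eq_mul,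
      Finset.mul_sum]
    rw [Finset.sum_comm]
    refine Finset.sum_congr rfl fun i _ => Finset.sum_congr rfl fun k _ => ?_
    rw [real_inner_comm (b a) (e k)]
    ring
  simp_rw [h1]
  rw [Finset.sum_comm]
  refine Finset.sum_congr rfl fun i _ => ?_
  rw [Finset.sum_comm]
  simp_rw [← Finset.sum_mul, b.sum_inner_mul_inner]
  rw [Finset.sum_eq_single i]
  · rw [real_inner_self_eq_norm_sq, e.orthonormal.1]; simp
  · intro k _ hk
    rw [e.orthonormal.2 hk.symm, zero_mul]
  · simp

/-- Second-order Taylor expansion with Peano remainder. -/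
lemma exists_abs_taylor_two_le {E : Type*} [NormedAddCommGroup E] [NormedSpace ℝ E] {F : E → ℝ}
    {x : E} (hF : ContDiffAt ℝ 2 F x) {ε : ℝ} (hε : 0 < ε) :
    ∃ δ > 0, ∀ u : E, ‖u‖ < δ →
      |F (x + u) - F x - fderiv ℝ F x u - fderiv ℝ (fderiv ℝ F) x u u / 2| ≤ ε * ‖u‖ ^ 2 := by
  have hsymm : IsSymmSndFDerivAt ℝ F x := hF.isSymmSndFDerivAt (by simp)
  have h1 : ContDiffAt ℝ 1 (fderiv ℝ F) x := hF.fderiv_right (by norm_num)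
  have h2 : HasFDerivAt (fderiv ℝ F) (fderiv ℝ (fderiv ℝ F) x) x :=
    (h1.differentiableAt one_ne_zero).hasFDerivAt
  have h3 : ∀ᶠ u : E in 𝓝 0, ‖fderiv ℝ F (x + u) - fderiv ℝ F x - fderiv ℝ (fderiv ℝ F) x u‖ ≤ ε * ‖u‖ :=
    (hasFDerivAt_iff_isLittleO_nhds_zero.1 h2).def hε
  have h4 : ∀ᶠ u : E in 𝓝 0, DifferentiableAt ℝ F (x + u) := by
    have h5 : ∀ᶠ z in 𝓝 x, DifferentiableAt ℝ F z :=
      (hF.eventually (by simp)).mono fun z hz => hz.differentiableAt two_ne_zero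
    have h6 : Tendsto (fun u : E => x + u) (𝓝 0) (𝓝 x) := by
      simpa using (tendsto_id (α := E) (x := 𝓝 0)).const_add x
    exact h6.eventually h5
  obtain ⟨δ, hδ, hball⟩ := Metric.eventually_nhds_iff.1 (h3.and h4)
  refine ⟨δ, hδ, fun u hu => ?_⟩
  let g : E → ℝ := fun v => F (x + v) - F x - fderiv ℝ F x v - fderiv ℝ (fderiv ℝ F) x v v / 2
  have hg : ∀ v ∈ Metric.closedBall (0 : E) ‖u‖, HasFDerivWithinAt g
      (fderiv ℝ F (x + v) - fderiv ℝ F x - fderiv ℝ (fderiv ℝ F) x v)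
      (Metric.closedBall (0 : E) ‖u‖) v := by
    intro v hv
    have hv' : dist v 0 < δ := lt_of_le_of_lt (Metric.mem_closedBall.1 hv) hu
    have e1 : HasFDerivAt (fun v => F (x + v)) (fderiv ℝ F (x + v)) v := by
      rw [hasFDerivAt_comp_add_left]
      exact (hball hv').2.hasFDerivAt
    -- Symmetry of the second derivative makes the quadratic form differentiate to twice the linear
    -- map.
    have e2 : HasFDerivAt (fun v => fderiv ℝ (fderiv ℝ F) x v v)
        ((2 : ℝ) • fderiv ℝ (fderiv ℝ F) x v) v := by
      have := (fderiv ℝ (fderiv ℝ F) x).hasFDerivAt (x := v) |>.clm_apply (hasFDerivAt_id v)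
      refine this.congr_fderiv ?_
      ext w
      simp [two_mul, hsymm.eq w v]
    have e3 := ((e1.sub_const (F x)).sub (fderiv ℝ F x).hasFDerivAt).sub (e2.const_mul (2⁻¹ : ℝ))
    refine HasFDerivAt.hasFDerivWithinAt ?_
    refine (e3.congr_fderiv ?_).congr_of_eventuallyEq (Eventually.of_forall fun v => ?_)
    · rw [smul_smul]; norm_num
    · simp only [g, Pi.sub_apply]; ring
  have hb : ∀ v ∈ Metric.closedBall (0 : E) ‖u‖,
      ‖fderiv ℝ F (x + v) - fderiv ℝ F x - fderiv ℝ (fderiv ℝ F) x v‖ ≤ ε * ‖u‖ := by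
    intro v hv
    have hv1 : ‖v‖ ≤ ‖u‖ := by simpa using hv
    have hv' : dist v 0 < δ := lt_of_le_of_lt (Metric.mem_closedBall.1 hv) hu
    exact (hball hv').1.trans (by gcongr)
  -- The mean value inequality on the ball of radius ‖u‖: the derivative is at most ε‖u‖ there, so
  -- the remainder at u is at most ε‖u‖².
  have := (convex_closedBall (0 : E) ‖u‖).norm_image_sub_le_of_norm_hasFDerivWithin_le hg hb
    (Metric.mem_closedBall_self (norm_nonneg u)) (show u ∈ Metric.closedBall 0 ‖u‖ by simp)
  have hg0 : g 0 = 0 := by simp [g]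
  rw [hg0, sub_zero, sub_zero, Real.norm_eq_abs] at this
  calc _ ≤ _ := this
    _ = _ := by ring

/-! ### Derivatives of the radial extension -/

section

variable {r : ℕ} {d : Fin r → ℕ}

lemma radialExt_toAmbient (f : Polysphere d → ℝ) (y : Polysphere d) :
    radialExt f y.toAmbient = f y := by
  have hn : ∀ j, ‖y.toAmbient j‖ = 1 := fun j => norm_eq_of_mem_sphere (y j)
  have h0 : ∀ j, y.toAmbient j ≠ 0 := fun j h => by have := hn j; rw [h, norm_zero] at this; simp at this
  rw [radialExt, dif_pos h0]
  congr 1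
  ext1 j
  apply Subtype.ext
  simp only [hn, inv_one, one_smul]
  rfl

lemma continuous_toAmbient : Continuous (Polysphere.toAmbient : Polysphere d → Ambient d) := by
  unfold Polysphere.toAmbient
  fun_prop

lemma RadialExtC2.continuous {f : Polysphere d → ℝ} (hf : RadialExtC2 f) : Continuous f := by
  have : f = radialExt f ∘ Polysphere.toAmbient := funext fun y => (radialExt_toAmbient f y).symm
  rw [this]
  refine continuous_iff_continuousAt.2 fun y => ?_
  exact (hf y).continuousAt.comp continuous_toAmbient.continuousAt

/-- The radial extension is constant along the radial directions. -/
lemma radialExt_add_radial (f : Polysphere d → ℝ) (x : Polysphere d) (j : Fin r) {t : ℝ}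
    (ht : -1 < t) :
    radialExt f (x.toAmbient + t • (Pi.single j (x j : EuclideanSpace ℝ (Fin (d j + 1))) : Ambient d)) =
      f x := by
  have key : ∀ i, ∃ c : ℝ, 0 < c ∧
      (x.toAmbient + t • (Pi.single j (x j : EuclideanSpace ℝ (Fin (d j + 1))) : Ambient d)) i =
        c • (x i : EuclideanSpace ℝ (Fin (d i + 1))) := by
    intro i
    by_cases h : i = j
    · subst h
      refine ⟨1 + t, by linarith, ?_⟩
      rw [Pi.add_apply, Pi.smul_apply, Pi.single_eq_same, add_smul, one_smul]
      rfl
    · refine ⟨1, one_pos, ?_⟩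
      rw [Pi.add_apply, Pi.smul_apply, Pi.single_eq_of_ne h, smul_zero, add_zero, one_smul]
      rfl
  have hx : ∀ i, (x i : EuclideanSpace ℝ (Fin (d i + 1))) ≠ 0 := fun i h => by
    have := norm_eq_of_mem_sphere (x i)
    rw [h, norm_zero] at this
    simp at this
  rw [radialExt, dif_pos]
  · congr 1
    ext1 i
    apply Subtype.ext
    obtain ⟨c, hc, h⟩ := key i
    simp only [h]
    rw [norm_smul, norm_eq_of_mem_sphere, mul_one, Real.norm_of_nonneg hc.le, smul_smul,
      inv_mul_cancel₀ hc.ne', one_smul]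
  · intro i
    obtain ⟨c, hc, h⟩ := key i
    rw [h]
    exact smul_ne_zero hc.ne' (hx i)

lemma fderiv_radialExt_radial {f : Polysphere d → ℝ} (hf : RadialExtC2 f) (x : Polysphere d)
    (j : Fin r) :
    fderiv ℝ (radialExt f) x.toAmbient (Pi.single j (x j : EuclideanSpace ℝ (Fin (d j + 1)))) = 0 := by
  set e : Ambient d := Pi.single j (x j : EuclideanSpace ℝ (Fin (d j + 1))) with he
  have h1 := ((hf x).differentiableAt two_ne_zero).hasFDerivAt.hasLineDerivAt e
  have h2 : HasDerivAt (fun t : ℝ => radialExt f (x.toAmbient + t • e)) 0 0 := by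
    refine (hasDerivAt_const (0 : ℝ) (f x)).congr_of_eventuallyEq ?_
    filter_upwards [Ioi_mem_nhds (show (-1 : ℝ) < 0 by norm_num)] with t ht
    exact radialExt_add_radial f x j ht
  exact HasDerivAt.unique h1 h2

/-- Along the ray both the increment and the first-order term vanish, so Taylor's estimate reads
|q|t²/2 ≤ ε t²‖e‖². The ε chosen makes the right side at most |q|t²/4, which forces q = 0. -/
lemma snd_fderiv_radialExt_radial {f : Polysphere d → ℝ} (hf : RadialExtC2 f) (x : Polysphere d)
    (j : Fin r) :
    fderiv ℝ (fderiv ℝ (radialExt f)) x.toAmbient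
      (Pi.single j (x j : EuclideanSpace ℝ (Fin (d j + 1))))
      (Pi.single j (x j : EuclideanSpace ℝ (Fin (d j + 1)))) = 0 := by
  have h1 := fderiv_radialExt_radial hf x j
  have h2 := fun t ht => radialExt_add_radial f x j (t := t) ht
  set e : Ambient d := Pi.single j (x j : EuclideanSpace ℝ (Fin (d j + 1))) with he
  by_contra hne
  set q := fderiv ℝ (fderiv ℝ (radialExt f)) x.toAmbient e e with hq
  have hε : 0 < |q| / (4 * (‖e‖ ^ 2 + 1)) := div_pos (abs_pos.2 hne) (by positivity)
  obtain ⟨δ, hδ, H⟩ := exists_abs_taylor_two_le (hf x) hε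
  obtain ⟨t, ht0, ht⟩ : ∃ t : ℝ, 0 < t ∧ t * ‖e‖ < δ := by
    refine ⟨δ / (2 * (‖e‖ + 1)), by positivity, ?_⟩
    rw [div_mul_eq_mul_div, div_lt_iff₀ (by positivity)]
    nlinarith [norm_nonneg e]
  have h3 := H (t • e) (by rwa [norm_smul, Real.norm_of_nonneg ht0.le])
  rw [h2 t (by linarith), radialExt_toAmbient, map_smul, h1, map_smul, map_smul, smul_apply, ← hq] at h3
  simp only [sub_self, smul_eq_mul, mul_zero, zero_sub, abs_neg] at h3
  rw [norm_smul, Real.norm_of_nonneg ht0.le, ← mul_assoc, abs_div, abs_mul,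
    abs_of_pos (mul_pos ht0 ht0), abs_two, div_mul_eq_mul_div, le_div_iff₀ (by positivity)] at h3
  have h4 : 0 < |q| := abs_pos.2 hne
  have h5 : 0 < t * t * |q| := by positivity
  nlinarith [mul_nonneg h5.le (sq_nonneg ‖e‖)]

/-! ### Expansion in the tangential part -/

/-- The sum over the factors of `1 - x_j'y_j`. -/
def capSum (x y : Polysphere d) : ℝ :=
  ∑ j, (1 - ⟪(x j : EuclideanSpace ℝ (Fin (d j + 1))), (y j : EuclideanSpace ℝ (Fin (d j + 1)))⟫)

lemma one_sub_inner_nonneg {k : ℕ} (x y : Sph k) :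
    0 ≤ 1 - ⟪(x : EuclideanSpace ℝ (Fin (k + 1))), (y : EuclideanSpace ℝ (Fin (k + 1)))⟫ := by
  have := real_inner_le_norm (x : EuclideanSpace ℝ (Fin (k + 1))) y
  rw [norm_eq_of_mem_sphere, norm_eq_of_mem_sphere, one_mul] at this
  linarith

lemma capSum_nonneg (x y : Polysphere d) : 0 ≤ capSum x y :=
  Finset.sum_nonneg fun _ _ => one_sub_inner_nonneg _ _

lemma one_sub_inner_le_capSum (x y : Polysphere d) (j : Fin r) :
    1 - ⟪(x j : EuclideanSpace ℝ (Fin (d j + 1))), (y j : EuclideanSpace ℝ (Fin (d j + 1)))⟫ ≤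
      capSum x y :=
  Finset.single_le_sum (f := fun j => 1 - ⟪(x j : EuclideanSpace ℝ (Fin (d j + 1))),
    (y j : EuclideanSpace ℝ (Fin (d j + 1)))⟫) (fun _ _ => one_sub_inner_nonneg _ _)
    (Finset.mem_univ j)

lemma norm_toAmbient_sub_le (x y : Polysphere d) :
    ‖y.toAmbient - x.toAmbient‖ ≤ √(2 * capSum x y) := by
  refine (pi_norm_le_iff_of_nonneg (Real.sqrt_nonneg _)).2 fun j => ?_
  refine Real.le_sqrt_of_sq_le ?_
  have h1 : ‖(y.toAmbient - x.toAmbient) j‖ ^ 2 = 2 * (1 - ⟪(x j : EuclideanSpace ℝ (Fin (d j + 1))),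
      (y j : EuclideanSpace ℝ (Fin (d j + 1)))⟫) := by
    change ‖(y j : EuclideanSpace ℝ (Fin (d j + 1))) - x j‖ ^ 2 = _
    rw [norm_sub_sq_real, norm_eq_of_mem_sphere, norm_eq_of_mem_sphere, real_inner_comm]
    ring
  rw [h1]
  linarith [one_sub_inner_le_capSum x y j]

/-- The tangential part at `x` of `y`. -/
def tangentPart (x y : Polysphere d) : Ambient d := fun j =>
  (y j : EuclideanSpace ℝ (Fin (d j + 1))) -
      ⟪(x j : EuclideanSpace ℝ (Fin (d j + 1))), (y j : EuclideanSpace ℝ (Fin (d j + 1)))⟫ •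
        (x j : EuclideanSpace ℝ (Fin (d j + 1)))

lemma continuous_tangentPart (x : Polysphere d) : Continuous (tangentPart x) := by
  unfold tangentPart
  fun_prop

lemma toAmbient_sub_eq (x y : Polysphere d) :
    y.toAmbient - x.toAmbient = tangentPart x y -
      ∑ j, (1 - ⟪(x j : EuclideanSpace ℝ (Fin (d j + 1))), (y j : EuclideanSpace ℝ (Fin (d j + 1)))⟫) •
        (Pi.single j (x j : EuclideanSpace ℝ (Fin (d j + 1))) : Ambient d) := by
  ext1 j
  rw [Pi.sub_apply, Pi.sub_apply, Finset.sum_apply, Finset.sum_eq_single j]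
  · rw [Pi.smul_apply, Pi.single_eq_same, sub_smul, one_smul]
    simp only [tangentPart, Polysphere.toAmbient]
    abel
  · intro k _ hk
    rw [Pi.smul_apply, Pi.single_eq_of_ne hk.symm, smul_zero]
  · simp

lemma norm_radialPart_le (x y : Polysphere d) :
    ‖∑ j, (1 - ⟪(x j : EuclideanSpace ℝ (Fin (d j + 1))), (y j : EuclideanSpace ℝ (Fin (d j + 1)))⟫) •
        (Pi.single j (x j : EuclideanSpace ℝ (Fin (d j + 1))) : Ambient d)‖ ≤ capSum x y := by
  refine (norm_sum_le _ _).trans (Finset.sum_le_sum fun j _ => ?_)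
  rw [norm_smul, Pi.norm_single, norm_eq_of_mem_sphere, mul_one,
    Real.norm_of_nonneg (one_sub_inner_nonneg _ _)]

lemma continuous_capSum (x : Polysphere d) : Continuous (capSum x) := by
  unfold capSum
  fun_prop

/-- The remainder of the second-order expansion of `f` in the tangential part. -/
def tangentRemainder (f : Polysphere d → ℝ) (x y : Polysphere d) : ℝ :=
  f y - f x - fderiv ℝ (radialExt f) x.toAmbient (tangentPart x y) -
    fderiv ℝ (fderiv ℝ (radialExt f)) x.toAmbient (tangentPart x y) (tangentPart x y) / 2

lemma continuous_tangentRemainder {f : Polysphere d → ℝ} (hf : RadialExtC2 f) (x : Polysphere d) :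
    Continuous (tangentRemainder f x) := by
  have h1 := hf.continuous
  have h2 := continuous_tangentPart x
  unfold tangentRemainder
  fun_prop

/-- With N = `capSum x y`, the displacement has size at most √(2N) and its radial part at most N.
The first derivative kills the radial part, and replacing the displacement by its tangential part in
the quadratic form costs O(N^(3/2) + N²). Away from x, compactness and the term C N² suffice; the
bound is thus global in y and can be integrated. -/
lemma abs_tangentRemainder_le {f : Polysphere d → ℝ} (hf : RadialExtC2 f) (x : Polysphere d)
    {ε : ℝ} (hε : 0 < ε) :
    ∃ C, 0 ≤ C ∧ ∀ y, |tangentRemainder f x y| ≤ ε * capSum x y + C * capSum x y ^ 2 := by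
  -- As ‖u‖² ≤ 2N, ε/4 turns into εN/2; the other half of εN is left for the radial cross terms.
  obtain ⟨δ, hδ, H⟩ := exists_abs_taylor_two_le (hf x) (show 0 < ε / 4 by positivity)
  obtain ⟨K, hK⟩ := isCompact_univ.exists_bound_of_continuousOn
    (continuous_tangentRemainder hf x).continuousOn
  set A := fderiv ℝ (radialExt f) x.toAmbient with hA
  set B := fderiv ℝ (fderiv ℝ (radialExt f)) x.toAmbient with hB
  have hev : ∀ᶠ N : ℝ in 𝓝 0, √(2 * N) < δ ∧ ‖B‖ * (2 * √(2 * N) + N) < ε := by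
    have c1 : Continuous fun N : ℝ => √(2 * N) := by fun_prop
    have c2 : Continuous fun N : ℝ => ‖B‖ * (2 * √(2 * N) + N) := by fun_prop
    refine ((c1.tendsto 0).eventually_lt_const (by simpa using hδ)).and
      ((c2.tendsto 0).eventually_lt_const (by simpa using hε))
  obtain ⟨η, hη, hball⟩ := Metric.eventually_nhds_iff.1 hev
  -- K bounds the remainder everywhere, and N²/η² ≥ 1 as soon as N ≥ η.
  refine ⟨|K| / η ^ 2, by positivity, fun y => ?_⟩
  have hN0 := capSum_nonneg x y
  set N := capSum x y with hN
  rcases lt_or_ge N η with hlt | hge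
  · obtain ⟨h1, h2⟩ := hball (y := N) (by rwa [Real.dist_eq, sub_zero, abs_of_nonneg hN0])
    have hu := norm_toAmbient_sub_le x y
    have ha := norm_radialPart_le x y
    have hua := toAmbient_sub_eq x y
    set a : Ambient d := ∑ j, (1 - ⟪(x j : EuclideanSpace ℝ (Fin (d j + 1))),
      (y j : EuclideanSpace ℝ (Fin (d j + 1)))⟫) •
        (Pi.single j (x j : EuclideanSpace ℝ (Fin (d j + 1))) : Ambient d) with ha_def
    set u : Ambient d := y.toAmbient - x.toAmbient with hu_def
    have hp : tangentPart x y = u + a := by rw [hua]; abel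
    have hAa : A a = 0 := by
      rw [ha_def, map_sum]
      refine Finset.sum_eq_zero fun j _ => ?_
      rw [map_smul, fderiv_radialExt_radial hf x j, smul_zero]
    have hT := H u (lt_of_le_of_lt hu h1)
    have hxu : x.toAmbient + u = y.toAmbient := by rw [hu_def]; abel
    rw [hxu, radialExt_toAmbient, radialExt_toAmbient] at hT
    have hrem : tangentRemainder f x y = (f y - f x - A u - B u u / 2) -
        (B a u + B u a + B a a) / 2 := by
      rw [tangentRemainder, hp, ← hA, ← hB]
      simp only [map_add, hAa, add_apply]
      ring
    have hu2 : ‖u‖ ^ 2 ≤ 2 * N := by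
      calc ‖u‖ ^ 2 ≤ √(2 * N) ^ 2 := by gcongr
        _ = 2 * N := Real.sq_sqrt (by positivity)
    have b1 : |B a u| ≤ ‖B‖ * N * √(2 * N) := (B.le_opNorm₂ a u).trans (by gcongr)
    have b2 : |B u a| ≤ ‖B‖ * √(2 * N) * N := (B.le_opNorm₂ u a).trans (by gcongr)
    have b3 : |B a a| ≤ ‖B‖ * N * N := (B.le_opNorm₂ a a).trans (by gcongr)
    have b4 : ‖B‖ * (2 * √(2 * N) + N) * N ≤ ε * N := mul_le_mul_of_nonneg_right h2.le hN0
    have b5 : |(B a u + B u a + B a a) / 2| ≤ ε * N / 2 := by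
      rw [abs_div, abs_two]
      have := abs_add_three (B a u) (B u a) (B a a)
      linarith
    have b6 : ε / 4 * ‖u‖ ^ 2 ≤ ε / 4 * (2 * N) := by gcongr
    have b7 := abs_sub (f y - f x - A u - B u u / 2) ((B a u + B u a + B a a) / 2)
    rw [hrem]
    have : 0 ≤ |K| / η ^ 2 * N ^ 2 := by positivity
    linarith
  · have h1 : |tangentRemainder f x y| ≤ |K| := (hK y trivial).trans (le_abs_self K)
    have h2 : |K| ≤ |K| / η ^ 2 * N ^ 2 := by
      rw [div_mul_eq_mul_div, le_div_iff₀ (by positivity)]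
      gcongr
    have : 0 ≤ ε * N := by positivity
    linarith

lemma abs_sub_le_capSum {f : Polysphere d → ℝ} (hf : RadialExtC2 f) (x : Polysphere d)
    {ε : ℝ} (hε : 0 < ε) :
    ∃ C, 0 ≤ C ∧ ∀ y, |f y - f x| ≤ ε + C * capSum x y := by
  obtain ⟨K, hK⟩ := isCompact_univ.exists_bound_of_continuousOn
    (hf.continuous.sub (continuous_const (y := f x))).continuousOn
  obtain ⟨δ, hδ, H⟩ := Metric.continuousAt_iff.1 (hf x).continuousAt ε hε
  refine ⟨|K| / (δ ^ 2 / 4), by positivity, fun y => ?_⟩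
  have hN0 := capSum_nonneg x y
  rcases lt_or_ge (capSum x y) (δ ^ 2 / 4) with hlt | hge
  · have h1 : dist y.toAmbient x.toAmbient < δ := by
      rw [dist_eq_norm]
      refine (norm_toAmbient_sub_le x y).trans_lt ?_
      rw [Real.sqrt_lt' hδ]
      nlinarith
    have h2 := H h1
    rw [radialExt_toAmbient, radialExt_toAmbient, Real.dist_eq] at h2
    have : 0 ≤ |K| / (δ ^ 2 / 4) * capSum x y := by positivity
    linarith
  · have h1 : |f y - f x| ≤ |K| := (hK y trivial).trans (le_abs_self K)
    have h2 : |K| ≤ |K| / (δ ^ 2 / 4) * capSum x y := by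
      rw [div_mul_eq_mul_div, le_div_iff₀ (by positivity)]
      gcongr
    linarith

lemma AdaptedBasis.sum_coord_smul_vec_eq {x : Polysphere d} (b : AdaptedBasis x) (y : Polysphere d) :
    ∑ i, b.coord i y • b.vec i = tangentPart x y :=
  funext fun j => b.sum_coord_smul_vec y j

lemma exists_adaptedBasis (x : Polysphere d) : Nonempty (AdaptedBasis x) := by
  choose b hb using fun j => exists_orthonormalBasis_zero (x j)
  exact ⟨⟨b, hb⟩⟩

/-- The trace of the `j`-th diagonal block of the Hessian of the radial extension. -/
lemma AdaptedBasis.sum_snd_fderiv_eq_trace {x : Polysphere d} (b : AdaptedBasis x)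
    {f : Polysphere d → ℝ} (hf : RadialExtC2 f) (j : Fin r) :
    ∑ a : Fin (d j), fderiv ℝ (fderiv ℝ (radialExt f)) x.toAmbient (b.vec ⟨j, a.succ⟩)
      (b.vec ⟨j, a.succ⟩) = (Matrix.blockDiag' (hessian (radialExt f) x.toAmbient) j).trace := by
  set B := fderiv ℝ (fderiv ℝ (radialExt f)) x.toAmbient with hB
  let ι := LinearMap.single ℝ (fun j => EuclideanSpace ℝ (Fin (d j + 1))) j
  let B' : EuclideanSpace ℝ (Fin (d j + 1)) →ₗ[ℝ] EuclideanSpace ℝ (Fin (d j + 1)) →ₗ[ℝ] ℝ :=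
    LinearMap.mk₂ ℝ (fun u v => B (ι u) (ι v)) (by simp) (by simp) (by simp) (by simp)
  have h1 := sum_bilin_orthonormalBasis (b.basis j) (EuclideanSpace.basisFun (Fin (d j + 1)) ℝ) B'
  have h2 : B' (b.basis j 0) (b.basis j 0) = 0 := by
    rw [b.basis_zero]
    exact snd_fderiv_radialExt_radial hf x j
  rw [Fin.sum_univ_succ, h2, zero_add] at h1
  have h3 : ∑ a : Fin (d j), B (b.vec ⟨j, a.succ⟩) (b.vec ⟨j, a.succ⟩) =
      ∑ a : Fin (d j), B' (b.basis j a.succ) (b.basis j a.succ) := rfl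
  rw [h3, h1, Matrix.trace]
  refine Finset.sum_congr rfl fun a _ => ?_
  rw [EuclideanSpace.basisFun_apply]
  rfl

lemma continuous_capVec_apply (h : Fin r → ℝ) (x : Polysphere d) (j : Fin r) :
    Continuous fun y => capVec h x y j := by
  unfold capVec
  fun_prop

lemma HasMoments.integrable_mul_pow {G : (Fin r → ℝ) → ℝ} (hG : HasMoments G) (h : Fin r → ℝ)
    (x : Polysphere d) (j : Fin r) (p : ℕ) :
    Integrable (fun y => G (capVec h x y) * capVec h x y j ^ p) (polyMeasure d) :=
  hG.integrable_mul h x ((continuous_capVec_apply h x j).pow p)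

lemma one_sub_inner_eq {h : Fin r → ℝ} (hh : ∀ j, 0 < h j) (x y : Polysphere d) (j : Fin r) :
    1 - ⟪(x j : EuclideanSpace ℝ (Fin (d j + 1))), (y j : EuclideanSpace ℝ (Fin (d j + 1)))⟫ =
      h j ^ 2 * capVec h x y j := by
  have := (hh j).ne'
  rw [capVec]
  field_simp

lemma capSum_eq {h : Fin r → ℝ} (hh : ∀ j, 0 < h j) (x y : Polysphere d) :
    capSum x y = ∑ j, h j ^ 2 * capVec h x y j :=
  Finset.sum_congr rfl fun j _ => one_sub_inner_eq hh x y j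

/-! ### Local averages against a rescaled kernel -/

section

variable {G : (Fin r → ℝ) → ℝ}

lemma rho_inv_mul_integral (G : (Fin r → ℝ) → ℝ) (h : Fin r → ℝ) (x : Polysphere d) (j : Fin r) :
    (rho d h)⁻¹ * ∫ y, G (capVec h x y) ∂(polyMeasure d) = capMoment G h x j 0 := by
  simp [capMoment]

lemma integral_mul_capSum (hG : HasMoments G) {h : Fin r → ℝ} (hh : ∀ j, 0 < h j)
    (x : Polysphere d) :
    (rho d h)⁻¹ * ∫ y, G (capVec h x y) * capSum x y ∂(polyMeasure d) =
      ∑ j, h j ^ 2 * capMoment G h x j 1 := by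
  have h1 : ∀ y, G (capVec h x y) * capSum x y =
      ∑ j, h j ^ 2 * (G (capVec h x y) * capVec h x y j ^ 1) := by
    intro y
    rw [capSum_eq hh, Finset.mul_sum]
    exact Finset.sum_congr rfl fun j _ => by ring
  simp_rw [h1]
  rw [integral_finsetSum _ fun j _ => (hG.integrable_mul_pow h x j 1).const_mul _, Finset.mul_sum]
  refine Finset.sum_congr rfl fun j _ => ?_
  rw [integral_const_mul, capMoment]
  ring

lemma integral_mul_capSum_sq_le (hG : HasMoments G) {h : Fin r → ℝ} (hh : ∀ j, 0 < h j)
    (x : Polysphere d) :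
    (rho d h)⁻¹ * ∫ y, G (capVec h x y) * capSum x y ^ 2 ∂(polyMeasure d) ≤
      ∑ j, r * h j ^ 4 * capMoment G h x j 2 := by
  have hint : ∀ j, Integrable (fun y => r * h j ^ 4 * (G (capVec h x y) * capVec h x y j ^ 2))
      (polyMeasure d) := fun j =>
    (hG.integrable_mul_pow h x j 2).const_mul _
  have h1 : ∫ y, G (capVec h x y) * capSum x y ^ 2 ∂(polyMeasure d) ≤
      ∫ y, ∑ j, r * h j ^ 4 * (G (capVec h x y) * capVec h x y j ^ 2) ∂(polyMeasure d) := by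
    refine integral_mono (hG.integrable_mul h x ((continuous_capSum x).pow 2))
      (integrable_finsetSum _ fun j _ => hint j) fun y => ?_
    have h2 : capSum x y ^ 2 ≤ r * ∑ j, (h j ^ 2 * capVec h x y j) ^ 2 := by
      rw [capSum_eq hh]
      simpa using sq_sum_le_card_mul_sum_sq (s := Finset.univ)
        (f := fun j => h j ^ 2 * capVec h x y j)
    calc G (capVec h x y) * capSum x y ^ 2 ≤
        G (capVec h x y) * (r * ∑ j, (h j ^ 2 * capVec h x y j) ^ 2) :=
          mul_le_mul_of_nonneg_left h2 (hG.nonneg _ (capVec_nonneg h x y))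
      _ = _ := by
          rw [Finset.mul_sum, Finset.mul_sum]
          exact Finset.sum_congr rfl fun j _ => by ring
  calc _ ≤ (rho d h)⁻¹ * ∫ y, ∑ j, r * h j ^ 4 * (G (capVec h x y) * capVec h x y j ^ 2) ∂(polyMeasure d) :=
        mul_le_mul_of_nonneg_left h1 (inv_nonneg.2 (rho_pos d hh).le)
    _ = _ := by
        rw [integral_finsetSum _ fun j _ => hint j, Finset.mul_sum]
        refine Finset.sum_congr rfl fun j _ => ?_
        rw [integral_const_mul, capMoment]
        ring

lemma capMoment_nonneg (hG : HasMoments G) {h : Fin r → ℝ} (hh : ∀ j, 0 < h j)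
    (x : Polysphere d) (j : Fin r) (p : ℕ) : 0 ≤ capMoment G h x j p :=
  mul_nonneg (inv_nonneg.2 (rho_pos d hh).le) (integral_nonneg fun y =>
    mul_nonneg (hG.nonneg _ (capVec_nonneg h x y)) (pow_nonneg (capVec_nonneg h x y j) p))

/-- Local averages against a rescaled kernel concentrate at the centre. -/
lemma tendsto_integral_mul (hr : 1 ≤ r) (hd : ∀ j, 1 ≤ d j) {f : Polysphere d → ℝ}
    (hf : RadialExtC2 f) (hG : HasMoments G) {h : ℕ → Fin r → ℝ} (hpos : ∀ n j, 0 < h n j)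
    (hlim : Tendsto h atTop (𝓝 0)) (x : Polysphere d) :
    Tendsto (fun n => (rho d (h n))⁻¹ * ∫ y, G (capVec (h n) x y) * f y ∂(polyMeasure d)) atTop
      (𝓝 (lam d G * f x)) := by
  let j₀ : Fin r := ⟨0, hr⟩
  have hm := fun j p => tendsto_capMoment hd hpos hlim hG x j p
  have hm0 : Tendsto (fun n => capMoment G (h n) x j₀ 0) atTop (𝓝 (lam d G)) := by
    simpa using hm j₀ 0
  have hdiff : Tendsto (fun n => (rho d (h n))⁻¹ *
      ∫ y, G (capVec (h n) x y) * (f y - f x) ∂(polyMeasure d)) atTop (𝓝 0) := by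
    rw [Metric.tendsto_nhds]
    intro ε hε
    have hlam : 0 ≤ lam d G := ge_of_tendsto' hm0 fun n => capMoment_nonneg hG (hpos n) x _ _
    -- The constant part integrates in the limit to ε λ/(2(λ+1)) < ε with λ = `lam d G`; the part in
    -- `capSum` carries factors h_j² and disappears.
    obtain ⟨C, hC, H⟩ := abs_sub_le_capSum hf x (show 0 < ε / (2 * (lam d G + 1)) by positivity)
    have hb : Tendsto (fun n => ε / (2 * (lam d G + 1)) * capMoment G (h n) x j₀ 0 +
        C * ∑ j, h n j ^ 2 * capMoment G (h n) x j 1) atTop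
        (𝓝 (ε / (2 * (lam d G + 1)) * lam d G + C * ∑ j : Fin r, 0 ^ 2 * lam d fun s => G s * s j ^ 1)) :=
      (hm0.const_mul _).add ((tendsto_finsetSum _ fun j _ =>
        ((tendsto_pi_nhds.1 hlim j).pow 2).mul (hm j 1)).const_mul _)
    have hlt : ε / (2 * (lam d G + 1)) * lam d G +
        C * ∑ j : Fin r, 0 ^ 2 * (lam d fun s => G s * s j ^ 1) < ε := by
      have : ε / (2 * (lam d G + 1)) * lam d G < ε := by
        rw [div_mul_eq_mul_div, div_lt_iff₀ (by positivity)]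
        nlinarith
      simpa using this
    filter_upwards [hb.eventually_lt_const hlt] with n hn
    rw [Real.dist_eq, sub_zero, abs_mul, abs_of_pos (inv_pos.2 (rho_pos d (hpos n)))]
    refine lt_of_le_of_lt ?_ hn
    have i1 := hG.integrable_mul (h n) x (F := fun _ => ε / (2 * (lam d G + 1))) continuous_const
    have i2 := hG.integrable_mul (h n) x ((continuous_capSum x).const_mul C)
    have h1 : |∫ y, G (capVec (h n) x y) * (f y - f x) ∂(polyMeasure d)| ≤
        ∫ y, (G (capVec (h n) x y) * (ε / (2 * (lam d G + 1))) +
          G (capVec (h n) x y) * (C * capSum x y)) ∂(polyMeasure d) := by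
      rw [← Real.norm_eq_abs]
      refine norm_integral_le_of_norm_le (i1.add i2) (ae_of_all _ fun y => ?_)
      have h0 := hG.nonneg _ (capVec_nonneg (h n) x y)
      rw [norm_mul, Real.norm_of_nonneg h0, ← mul_add]
      exact mul_le_mul_of_nonneg_left (H y) h0
    calc _ ≤ (rho d (h n))⁻¹ * _ :=
          mul_le_mul_of_nonneg_left h1 (inv_nonneg.2 (rho_pos d (hpos n)).le)
      _ = _ := by
        rw [integral_add i1 i2, integral_mul_const, ← integral_mul_capSum hG (hpos n) x,
          ← rho_inv_mul_integral]
        simp_rw [mul_left_comm _ C, integral_const_mul]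
        ring
  have h2 := hdiff.add (hm0.mul_const (f x))
  rw [zero_add] at h2
  refine h2.congr fun n => ?_
  have i1 := hG.integrable_mul (h n) x hf.continuous
  have i2 := hG.integrable_mul (h n) x (F := fun _ => f x) continuous_const
  simp_rw [mul_sub]
  rw [integral_sub i1 i2, ← rho_inv_mul_integral, integral_mul_const]
  ring

lemma isLittleO_integral_tangentRemainder (hd : ∀ j, 1 ≤ d j) {f : Polysphere d → ℝ}
    (hf : RadialExtC2 f) (hG : HasMoments G) {h : ℕ → Fin r → ℝ} (hpos : ∀ n j, 0 < h n j)
    (hlim : Tendsto h atTop (𝓝 0)) (x : Polysphere d) :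
    (fun n => (rho d (h n))⁻¹ * ∫ y, G (capVec (h n) x y) * tangentRemainder f x y ∂(polyMeasure d))
      =o[atTop] fun n => ∑ j, h n j ^ 2 := by
  have hm := fun j p => tendsto_capMoment hd hpos hlim hG x j p
  rw [isLittleO_iff]
  intro ε hε
  have hl : ∀ j, 0 ≤ lam d fun s => G s * s j ^ 1 := fun j =>
    ge_of_tendsto' (hm j 1) fun n => capMoment_nonneg hG (hpos n) x _ _
  set D := ∑ j, lam d fun s => G s * s j ^ 1 with hD
  have hD0 : 0 ≤ D := Finset.sum_nonneg fun j _ => hl j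
  obtain ⟨C, hC, H⟩ := abs_tangentRemainder_le hf x (show 0 < ε / (2 * (D + 1)) by positivity)
  -- The coefficient of h_j² in the final bound, controlled for each j separately because the
  -- bandwidths may be of different orders. The second moment enters as h_j⁴ = h_j² · h_j².
  have hev : ∀ᶠ n in atTop, ∀ j, ε / (2 * (D + 1)) * capMoment G (h n) x j 1 +
      C * (r * h n j ^ 2 * capMoment G (h n) x j 2) ≤ ε := by
    refine eventually_all.2 fun j => ?_
    have hb : Tendsto (fun n => ε / (2 * (D + 1)) * capMoment G (h n) x j 1 +
        C * (r * h n j ^ 2 * capMoment G (h n) x j 2)) atTop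
        (𝓝 (ε / (2 * (D + 1)) * (lam d fun s => G s * s j ^ 1) +
          C * (r * 0 ^ 2 * lam d fun s => G s * s j ^ 2))) :=
      ((hm j 1).const_mul _).add (((((tendsto_pi_nhds.1 hlim j).pow 2).const_mul _).mul (hm j 2)).const_mul _)
    refine (hb.eventually_lt_const ?_).mono fun n hn => hn.le
    have h1 : (lam d fun s => G s * s j ^ 1) ≤ D :=
      Finset.single_le_sum (f := fun j => lam d fun s => G s * s j ^ 1) (fun j _ => hl j) (Finset.mem_univ j)
    have : ε / (2 * (D + 1)) * (lam d fun s => G s * s j ^ 1) < ε := by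
      rw [div_mul_eq_mul_div, div_lt_iff₀ (by positivity)]
      nlinarith
    simpa using this
  filter_upwards [hev] with n hn
  have hs0 : 0 ≤ ∑ j, h n j ^ 2 := Finset.sum_nonneg fun j _ => sq_nonneg _
  rw [Real.norm_of_nonneg hs0, norm_mul, Real.norm_of_nonneg (inv_pos.2 (rho_pos d (hpos n))).le]
  have i1 := hG.integrable_mul (h n) x ((continuous_capSum x).const_mul (ε / (2 * (D + 1))))
  have i2 : Integrable (fun y => G (capVec (h n) x y) * (C * capSum x y ^ 2)) (polyMeasure d) :=
    hG.integrable_mul (h n) x (((continuous_capSum x).pow 2).const_mul C)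
  have h1 : ‖∫ y, G (capVec (h n) x y) * tangentRemainder f x y ∂(polyMeasure d)‖ ≤
      ∫ y, (G (capVec (h n) x y) * (ε / (2 * (D + 1)) * capSum x y) +
        G (capVec (h n) x y) * (C * capSum x y ^ 2)) ∂(polyMeasure d) := by
    refine norm_integral_le_of_norm_le (i1.add i2) (ae_of_all _ fun y => ?_)
    have h0 := hG.nonneg _ (capVec_nonneg (h n) x y)
    rw [norm_mul, Real.norm_of_nonneg h0, ← mul_add]
    exact mul_le_mul_of_nonneg_left (H y) h0
  calc _ ≤ (rho d (h n))⁻¹ * _ :=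
        mul_le_mul_of_nonneg_left h1 (inv_nonneg.2 (rho_pos d (hpos n)).le)
    _ = ε / (2 * (D + 1)) * ((rho d (h n))⁻¹ * ∫ y, G (capVec (h n) x y) * capSum x y ∂(polyMeasure d)) +
        C * ((rho d (h n))⁻¹ * ∫ y, G (capVec (h n) x y) * capSum x y ^ 2 ∂(polyMeasure d)) := by
      rw [integral_add i1 i2]
      simp_rw [mul_left_comm _ C, mul_left_comm _ (ε / (2 * (D + 1))), integral_const_mul]
      ring
    _ ≤ ε / (2 * (D + 1)) * (∑ j, h n j ^ 2 * capMoment G (h n) x j 1) +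
        C * ∑ j, r * h n j ^ 4 * capMoment G (h n) x j 2 := by
      rw [integral_mul_capSum hG (hpos n) x]
      gcongr
      exact integral_mul_capSum_sq_le hG (hpos n) x
    _ = ∑ j, (ε / (2 * (D + 1)) * capMoment G (h n) x j 1 +
      C * (r * h n j ^ 2 * capMoment G (h n) x j 2)) * h n j ^ 2 := by
      rw [Finset.mul_sum, Finset.mul_sum, ← Finset.sum_add_distrib]
      exact Finset.sum_congr rfl fun j _ => by ring
    _ ≤ ∑ j, ε * h n j ^ 2 := Finset.sum_le_sum fun j _ =>
      mul_le_mul_of_nonneg_right (hn j) (sq_nonneg _)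
    _ = _ := by rw [Finset.mul_sum]

lemma integral_mul_one_sub_inner_sq (hG : HasMoments G) {h : Fin r → ℝ} (hh : ∀ j, 0 < h j)
    (x : Polysphere d) (j : Fin r) :
    (rho d h)⁻¹ * ∫ y, G (capVec h x y) * (1 - ⟪(x j : EuclideanSpace ℝ (Fin (d j + 1))),
        (y j : EuclideanSpace ℝ (Fin (d j + 1)))⟫ ^ 2) ∂(polyMeasure d) =
      2 * h j ^ 2 * capMoment G h x j 1 - h j ^ 4 * capMoment G h x j 2 := by
  have h1 : ∀ y, G (capVec h x y) * (1 - ⟪(x j : EuclideanSpace ℝ (Fin (d j + 1))),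
        (y j : EuclideanSpace ℝ (Fin (d j + 1)))⟫ ^ 2) =
      2 * h j ^ 2 * (G (capVec h x y) * capVec h x y j ^ 1) -
        h j ^ 4 * (G (capVec h x y) * capVec h x y j ^ 2) := by
    intro y
    have : ⟪(x j : EuclideanSpace ℝ (Fin (d j + 1))), (y j : EuclideanSpace ℝ (Fin (d j + 1)))⟫ =
        1 - h j ^ 2 * capVec h x y j := by rw [← one_sub_inner_eq hh]; ring
    rw [this]
    ring
  simp_rw [h1]
  rw [integral_sub, integral_const_mul, integral_const_mul, capMoment, capMoment]
  · ring
  · exact (hG.integrable_mul_pow h x j 1).const_mul _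
  · exact (hG.integrable_mul_pow h x j 2).const_mul _

/-- The expansion of local averages of a function with twice differentiable radial extension. -/
lemma integral_mul_sub_eq (hd : ∀ j, 1 ≤ d j) {f : Polysphere d → ℝ} (hf : RadialExtC2 f)
    (hG : HasMoments G) {h : Fin r → ℝ} (hh : ∀ j, 0 < h j) (x : Polysphere d) :
    (rho d h)⁻¹ * ∫ y, G (capVec h x y) * (f y - f x) ∂(polyMeasure d) =
      ∑ j, h j ^ 2 * ((Matrix.blockDiag' (hessian (radialExt f) x.toAmbient) j).trace *
        ((capMoment G h x j 1 - h j ^ 2 / 2 * capMoment G h x j 2) / d j)) +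
      (rho d h)⁻¹ * ∫ y, G (capVec h x y) * tangentRemainder f x y ∂(polyMeasure d) := by
  obtain ⟨b⟩ := exists_adaptedBasis x
  set A := fderiv ℝ (radialExt f) x.toAmbient with hA
  set B := fderiv ℝ (fderiv ℝ (radialExt f)) x.toAmbient with hB
  have hp := continuous_tangentPart x
  have i1 : Integrable (fun y => G (capVec h x y) * A (tangentPart x y)) (polyMeasure d) :=
    hG.integrable_mul h x (by fun_prop)
  have i2 : Integrable (fun y => G (capVec h x y) * B (tangentPart x y) (tangentPart x y))
      (polyMeasure d) := hG.integrable_mul h x (by fun_prop)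
  have i3 := hG.integrable_mul h x (continuous_tangentRemainder hf x)
  have i12 : Integrable (fun y => G (capVec h x y) * A (tangentPart x y) +
      2⁻¹ * (G (capVec h x y) * B (tangentPart x y) (tangentPart x y))) (polyMeasure d) :=
    i1.add (i2.const_mul _)
  have h1 : ∀ y, G (capVec h x y) * (f y - f x) = G (capVec h x y) * A (tangentPart x y) +
      2⁻¹ * (G (capVec h x y) * B (tangentPart x y) (tangentPart x y)) +
      G (capVec h x y) * tangentRemainder f x y := by
    intro y
    rw [tangentRemainder, ← hA, ← hB]
    ring
  have e1 := b.integral_linear hG h A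
  have e2 := b.integral_bilin hd hG h B
  simp_rw [b.sum_coord_smul_vec_eq] at e1 e2
  simp_rw [h1]
  rw [integral_add i12 i3, integral_add i1 (i2.const_mul _), e1,
    integral_const_mul, e2, zero_add, mul_add, Finset.mul_sum, Finset.mul_sum]
  congr 1
  refine Finset.sum_congr rfl fun j _ => ?_
  rw [hB, b.sum_snd_fderiv_eq_trace hf]
  have e3 := integral_mul_one_sub_inner_sq hG hh x j
  have hdj : (d j : ℝ) ≠ 0 := by have := hd j; positivity
  set T := (Matrix.blockDiag' (hessian (radialExt f) x.toAmbient) j).trace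
  set I := ∫ y, G (capVec h x y) * (1 - ⟪(x j : EuclideanSpace ℝ (Fin (d j + 1))),
        (y j : EuclideanSpace ℝ (Fin (d j + 1)))⟫ ^ 2) ∂(polyMeasure d)
  calc (rho d h)⁻¹ * (2⁻¹ * (T * ((d j : ℝ)⁻¹ * I))) =
      2⁻¹ * (T * ((d j : ℝ)⁻¹ * ((rho d h)⁻¹ * I))) := by ring
    -- The Taylor factor 1/2 halves 2h_j²S_j - h_j⁴S_j², leaving h_j²(S_j - h_j²S_j²/2).
    _ = _ := by rw [e3]; field_simp

end

/-! ### Mean and variance of the estimator at fixed n -/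

lemma normKernel_eq (hd : ∀ j, 1 ≤ d j) {h : Fin r → ℝ} (hh : ∀ j, 0 < h j)
    {L : (Fin r → ℝ) → ℝ} (hL : Measurable L) (x y : Polysphere d) :
    normKernel L h x y = (∫ z, L (capVec h x z) ∂(polyMeasure d))⁻¹ * L (capVec h x y) := by
  rw [normKernel, normConst_eq hd hh hL x y, rawKernel_eq]

/-- Splits the normalizing constant into ρ(h)⁻¹ and a factor with a finite limit. With p = 0 the
index j of `capMoment` is immaterial. -/
lemma inv_integral_eq {h : Fin r → ℝ} (hh : ∀ j, 0 < h j) (L : (Fin r → ℝ) → ℝ)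
    (x : Polysphere d) (j : Fin r) :
    (∫ z, L (capVec h x z) ∂(polyMeasure d))⁻¹ = (capMoment L h x j 0)⁻¹ * (rho d h)⁻¹ := by
  have := (rho_pos d hh).ne'
  rw [← rho_inv_mul_integral]
  field_simp

lemma integral_densityLaw {f : Polysphere d → ℝ} (hf : IsDensity d f) (g : Polysphere d → ℝ) :
    ∫ y, g y ∂(densityLaw d f) = ∫ y, g y * f y ∂(polyMeasure d) := by
  have hm := hf.measurable
  rw [densityLaw, integral_withDensity_eq_integral_toReal_smul (by fun_prop) (by simp)]
  congr 1
  ext y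
  rw [ENNReal.toReal_ofReal (hf.nonneg y), smul_eq_mul, mul_comm]

section Sample

variable {Ω : Type*} [MeasurableSpace Ω] {P : Measure Ω} {X : ℕ → Ω → Polysphere d}
  {f : Polysphere d → ℝ} {L : (Fin r → ℝ) → ℝ} {h : Fin r → ℝ}

lemma measurable_normKernel (hd : ∀ j, 1 ≤ d j) (hh : ∀ j, 0 < h j) (hL : Measurable L)
    (x : Polysphere d) : Measurable (normKernel L h x) := by
  have : normKernel L h x = fun y =>
      (∫ z, L (capVec h x z) ∂(polyMeasure d))⁻¹ * L (capVec h x y) :=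
    funext fun y => normKernel_eq hd hh hL x y
  rw [this]
  exact (hL.comp (measurable_capVec h x)).const_mul _

lemma memLp_normKernel [IsFiniteMeasure P] (hd : ∀ j, 1 ≤ d j) (hh : ∀ j, 0 < h j)
    (hL : IsKernel L) (hlaw : ∀ i, HasLaw (X i) (densityLaw d f) P) (x : Polysphere d) (i : ℕ) :
    MemLp (fun ω => normKernel L h x (X i ω)) 2 P := by
  obtain ⟨M, hM⟩ := hL.bounded
  refine MemLp.of_bound ((measurable_normKernel hd hh hL.measurable x).comp_aemeasurable
    (hlaw i).aemeasurable).aestronglyMeasurable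
    (|(∫ z, L (capVec h x z) ∂(polyMeasure d))⁻¹| * M) (ae_of_all _ fun ω => ?_)
  rw [normKernel_eq hd hh hL.measurable, norm_mul, Real.norm_eq_abs,
    Real.norm_of_nonneg (hL.nonneg _ (capVec_nonneg h x _))]
  exact mul_le_mul_of_nonneg_left (hM _ (capVec_nonneg h x _)) (abs_nonneg _)

lemma memLp_kde [IsFiniteMeasure P] (hd : ∀ j, 1 ≤ d j) (hh : ∀ j, 0 < h j)
    (hL : IsKernel L) (hlaw : ∀ i, HasLaw (X i) (densityLaw d f) P) (x : Polysphere d) (n : ℕ) :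
    MemLp (kde L X n h x) 2 P :=
  (memLp_finsetSum (Finset.range n) fun i _ => memLp_normKernel hd hh hL hlaw x i).const_mul _

lemma integral_comp_sample (hf : IsDensity d f) (hlaw : ∀ i, HasLaw (X i) (densityLaw d f) P)
    {g : Polysphere d → ℝ} (hg : Measurable g) (i : ℕ) :
    ∫ ω, g (X i ω) ∂P = ∫ y, g y * f y ∂(polyMeasure d) := by
  rw [← integral_densityLaw hf g, ← (hlaw i).integral_comp hg.aestronglyMeasurable]
  rfl

lemma integral_normKernel_sample (hd : ∀ j, 1 ≤ d j) (hh : ∀ j, 0 < h j) (hL : IsKernel L)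
    (hf : IsDensity d f) (hlaw : ∀ i, HasLaw (X i) (densityLaw d f) P) (x : Polysphere d)
    (j : Fin r) (i : ℕ) :
    ∫ ω, normKernel L h x (X i ω) ∂P = (capMoment L h x j 0)⁻¹ * ((rho d h)⁻¹ *
      ∫ y, L (capVec h x y) * f y ∂(polyMeasure d)) := by
  rw [integral_comp_sample hf hlaw (measurable_normKernel hd hh hL.measurable x)]
  simp_rw [normKernel_eq hd hh hL.measurable x, inv_integral_eq hh L x j, mul_assoc,
    integral_const_mul]

lemma integral_normKernel_sq_sample (hd : ∀ j, 1 ≤ d j) (hh : ∀ j, 0 < h j) (hL : IsKernel L)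
    (hf : IsDensity d f) (hlaw : ∀ i, HasLaw (X i) (densityLaw d f) P) (x : Polysphere d)
    (j : Fin r) (i : ℕ) :
    ∫ ω, normKernel L h x (X i ω) ^ 2 ∂P = (rho d h)⁻¹ * ((capMoment L h x j 0)⁻¹ ^ 2 *
      ((rho d h)⁻¹ * ∫ y, L (capVec h x y) ^ 2 * f y ∂(polyMeasure d))) := by
  rw [integral_comp_sample (g := fun y => normKernel L h x y ^ 2) hf hlaw
    ((measurable_normKernel hd hh hL.measurable x).pow_const 2)]
  simp_rw [normKernel_eq hd hh hL.measurable x, inv_integral_eq hh L x j, mul_pow, mul_assoc,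
    integral_const_mul]
  ring

lemma integral_kde [IsFiniteMeasure P] (hd : ∀ j, 1 ≤ d j) (hh : ∀ j, 0 < h j) (hL : IsKernel L)
    (hf : IsDensity d f) (hlaw : ∀ i, HasLaw (X i) (densityLaw d f) P) (x : Polysphere d)
    (j : Fin r) {n : ℕ} (hn : n ≠ 0) :
    ∫ ω, kde L X n h x ω ∂P = (capMoment L h x j 0)⁻¹ * ((rho d h)⁻¹ *
      ∫ y, L (capVec h x y) * f y ∂(polyMeasure d)) := by
  simp only [kde]
  rw [integral_const_mul, integral_finsetSum _ fun i _ =>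
    (memLp_normKernel hd hh hL hlaw x i).integrable one_le_two]
  simp_rw [integral_normKernel_sample hd hh hL hf hlaw x j]
  rw [Finset.sum_const, Finset.card_range, nsmul_eq_mul]
  field_simp

/-- Pulling out (nρ)⁻¹ leaves a bracket that converges: the squared mean acquires the vanishing
factor ρ. -/
lemma variance_kde [IsProbabilityMeasure P] (hd : ∀ j, 1 ≤ d j) (hh : ∀ j, 0 < h j)
    (hL : IsKernel L) (hf : IsDensity d f) (hindep : iIndepFun X P)
    (hlaw : ∀ i, HasLaw (X i) (densityLaw d f) P) (x : Polysphere d) (j : Fin r) {n : ℕ}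
    (hn : n ≠ 0) :
    variance (kde L X n h x) P = ((n : ℝ) * rho d h)⁻¹ *
      ((capMoment L h x j 0)⁻¹ ^ 2 *
        ((rho d h)⁻¹ * ∫ y, L (capVec h x y) ^ 2 * f y ∂(polyMeasure d)) -
        rho d h * ((capMoment L h x j 0)⁻¹ *
          ((rho d h)⁻¹ * ∫ y, L (capVec h x y) * f y ∂(polyMeasure d))) ^ 2) := by
  have hmem := fun i => memLp_normKernel hd hh hL hlaw x i
  have h1 : kde L X n h x = fun ω => (1 / (n : ℝ)) *
      (∑ i ∈ Finset.range n, fun ω => normKernel L h x (X i ω)) ω := by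
    ext ω
    rw [kde, Finset.sum_apply]
  have hm := measurable_normKernel hd hh hL.measurable x
  rw [h1, variance_const_mul, IndepFun.variance_sum (fun i _ => hmem i)
    fun i _ i' _ hne => (hindep.indepFun hne).comp hm hm]
  have h2 : ∀ i, variance (fun ω => normKernel L h x (X i ω)) P =
      (rho d h)⁻¹ * ((capMoment L h x j 0)⁻¹ ^ 2 *
        ((rho d h)⁻¹ * ∫ y, L (capVec h x y) ^ 2 * f y ∂(polyMeasure d))) -
        ((capMoment L h x j 0)⁻¹ *
          ((rho d h)⁻¹ * ∫ y, L (capVec h x y) * f y ∂(polyMeasure d))) ^ 2 := by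
    intro i
    rw [variance_eq_sub (hmem i), integral_normKernel_sample hd hh hL hf hlaw x j,
      ← integral_normKernel_sq_sample hd hh hL hf hlaw x j i]
    rfl
  simp_rw [h2]
  rw [Finset.sum_const, Finset.card_range, nsmul_eq_mul]
  have hr := (rho_pos d hh).ne'
  have hn' : (n : ℝ) ≠ 0 := Nat.cast_ne_zero.2 hn
  field_simp

end Sample

lemma tendsto_rho (hr : 1 ≤ r) (hd : ∀ j, 1 ≤ d j) {h : ℕ → Fin r → ℝ}
    (hlim : Tendsto h atTop (𝓝 0)) : Tendsto (fun n => rho d (h n)) atTop (𝓝 0) := by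
  have h1 : Tendsto (fun n => rho d (h n)) atTop (𝓝 (∏ j : Fin r, (0 : ℝ) ^ d j)) :=
    tendsto_finsetProd _ fun j _ => (tendsto_pi_nhds.1 hlim j).pow (d j)
  rwa [Finset.prod_eq_zero (Finset.mem_univ (⟨0, hr⟩ : Fin r))
    (zero_pow (by have := hd ⟨0, hr⟩; omega))] at h1

end

end

/-! ### Assembly -/

theorem theorem1 {r : ℕ} (hr : 1 ≤ r) (d : Fin r → ℕ) (hd : ∀ j, 1 ≤ d j)
    (f : Polysphere d → ℝ) (hf : IsDensity d f) (hA1 : RadialExtC2 f)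
    (L : (Fin r → ℝ) → ℝ) (hA2 : IsKernel L)
    (h : ℕ → Fin r → ℝ) (hpos : ∀ n j, 0 < h n j) (hlim : Tendsto h atTop (𝓝 0))
    (hrho : Tendsto (fun n : ℕ => (n : ℝ) * rho d (h n)) atTop atTop)
    {Ω : Type*} [MeasurableSpace Ω] (P : Measure Ω) [IsProbabilityMeasure P]
    (X : ℕ → Ω → Polysphere d) (hindep : iIndepFun X P)
    (hlaw : ∀ i, HasLaw (X i) (densityLaw d f) P)
    (x : Polysphere d) :
    (∀ n, MemLp (kde L X n (h n) x) 2 P) ∧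
    ((fun n : ℕ => (∫ ω, kde L X n (h n) x ω ∂P)
        - (f x + (fun j => h n j ^ 2) ⬝ᵥ
            (traceHess (radialExt f) x.toAmbient *ᵥ biasMoment d L)))
      =o[atTop] fun n : ℕ => ∑ j, h n j ^ 2) ∧
    ((fun n : ℕ => variance (kde L X n (h n) x) P
        - varMoment d L / ((n : ℝ) * rho d (h n)) * f x)
      =o[atTop] fun n : ℕ => ((n : ℝ) * rho d (h n))⁻¹) := by
  let j₀ : Fin r := ⟨0, hr⟩
  have hL := hA2.hasMoments
  have hlam : lam d L ≠ 0 := (lam_pos hd hA2).ne'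
  have hm := fun j p => tendsto_capMoment hd hpos hlim hL x j p
  have hm0 : Tendsto (fun n => capMoment L (h n) x j₀ 0) atTop (𝓝 (lam d L)) := by
    simpa using hm j₀ 0
  have hinv : Tendsto (fun n => (capMoment L (h n) x j₀ 0)⁻¹) atTop (𝓝 (lam d L)⁻¹) :=
    hm0.inv₀ hlam
  have hmean : Tendsto (fun n => (capMoment L (h n) x j₀ 0)⁻¹ * ((rho d (h n))⁻¹ *
      ∫ y, L (capVec (h n) x y) * f y ∂(polyMeasure d))) atTop (𝓝 (f x)) := by
    have := hinv.mul (tendsto_integral_mul hr hd hA1 hL hpos hlim x)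
    rwa [inv_mul_cancel_left₀ hlam] at this
  refine ⟨fun n => memLp_kde hd (hpos n) hA2 hlaw x n, ?_, ?_⟩
  · let T : Fin r → ℝ := fun j =>
      (Matrix.blockDiag' (hessian (radialExt f) x.toAmbient) j).trace
    -- The exact coefficient of h_j² in the bias minus its claimed limit; the bias error is ∑ a_j
    -- h_j² plus the normalized Taylor remainder.
    let a : ℕ → Fin r → ℝ := fun n j => T j * ((capMoment L (h n) x j₀ 0)⁻¹ *
      ((capMoment L (h n) x j 1 - h n j ^ 2 / 2 * capMoment L (h n) x j 2) / d j) - biasMoment d L j)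
    have ha : ∀ j, Tendsto (fun n => a n j) atTop (𝓝 0) := by
      intro j
      have h1 := (hinv.mul (((hm j 1).sub
        ((((tendsto_pi_nhds.1 hlim j).pow 2).div_const 2).mul (hm j 2))).div_const (d j : ℝ))).sub_const
          (biasMoment d L j) |>.const_mul (T j)
      have h2 : T j * ((lam d L)⁻¹ * (((lam d fun s => L s * s j ^ 1) -
          (0 : Fin r → ℝ) j ^ 2 / 2 * lam d fun s => L s * s j ^ 2) / d j) - biasMoment d L j) = 0 := by
        have hdj : (d j : ℝ) ≠ 0 := by have := hd j; positivity
        simp only [biasMoment, Pi.zero_apply, pow_one]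
        field_simp
        ring
      rw [h2] at h1
      exact h1
    have hmain : (fun n => ∑ j, a n j * h n j ^ 2) =o[atTop] fun n => ∑ j, h n j ^ 2 := by
      refine IsLittleO.fun_sum fun j _ => ?_
      have h1 : (fun n => h n j ^ 2) =O[atTop] fun n => ∑ j, h n j ^ 2 := by
        refine IsBigO.of_bound 1 (Eventually.of_forall fun n => ?_)
        rw [one_mul, Real.norm_of_nonneg (sq_nonneg _),
          Real.norm_of_nonneg (Finset.sum_nonneg fun j _ => sq_nonneg _)]
        exact Finset.single_le_sum (f := fun j => h n j ^ 2) (fun j _ => sq_nonneg _)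
          (Finset.mem_univ j)
      have h2 := ((isLittleO_one_iff ℝ).2 (ha j)).mul_isBigO h1
      simpa using h2
    have hrem := isLittleO_integral_tangentRemainder hd hA1 hL hpos hlim x
    have hrem2 : (fun n => (capMoment L (h n) x j₀ 0)⁻¹ * ((rho d (h n))⁻¹ *
        ∫ y, L (capVec (h n) x y) * tangentRemainder f x y ∂(polyMeasure d)))
        =o[atTop] fun n => ∑ j, h n j ^ 2 := by
      simpa using (hinv.isBigO_one ℝ).mul_isLittleO hrem
    refine (hmain.add hrem2).congr' ?_ EventuallyEq.rfl
    -- For n = 0 the estimator is 0, and the normalizing mass must be nonzero for f(x) to come out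
    -- with coefficient exactly 1.
    filter_upwards [eventually_ne_atTop 0, hm0.eventually_ne hlam] with n hn hne
    rw [integral_kde hd (hpos n) hA2 hf hlaw x j₀ hn]
    have e1 := integral_mul_sub_eq hd hA1 hL (hpos n) x
    have e2 : (rho d (h n))⁻¹ * ∫ y, L (capVec (h n) x y) * (f y - f x) ∂(polyMeasure d) =
        (rho d (h n))⁻¹ * (∫ y, L (capVec (h n) x y) * f y ∂(polyMeasure d)) -
          capMoment L (h n) x j₀ 0 * f x := by
      have i1 := hL.integrable_mul (h n) x hA1.continuous
      have i2 := hL.integrable_mul (h n) x (F := fun _ => f x) continuous_const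
      simp_rw [mul_sub]
      rw [integral_sub i1 i2, ← rho_inv_mul_integral, integral_mul_const]
      ring
    have e3 : (rho d (h n))⁻¹ * (∫ y, L (capVec (h n) x y) * f y ∂(polyMeasure d)) =
        capMoment L (h n) x j₀ 0 * f x + (∑ j, h n j ^ 2 * (T j *
        ((capMoment L (h n) x j 1 - h n j ^ 2 / 2 * capMoment L (h n) x j 2) / d j)) +
      (rho d (h n))⁻¹ * ∫ y, L (capVec (h n) x y) * tangentRemainder f x y ∂(polyMeasure d)) := by
      rw [← e1, e2]; ring
    have e4 : (fun j => h n j ^ 2) ⬝ᵥ (traceHess (radialExt f) x.toAmbient *ᵥ biasMoment d L) =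
        ∑ j, h n j ^ 2 * (T j * biasMoment d L j) := by
      rw [traceHess, dotProduct]
      refine Finset.sum_congr rfl fun j _ => ?_
      rw [Matrix.mulVec_diagonal]
    rw [e3, e4, mul_add, mul_add, inv_mul_cancel_left₀ hne, Finset.mul_sum]
    have e5 : ∑ j, a n j * h n j ^ 2 = (∑ j, (capMoment L (h n) x j₀ 0)⁻¹ * (h n j ^ 2 * (T j *
        ((capMoment L (h n) x j 1 - h n j ^ 2 / 2 * capMoment L (h n) x j 2) / d j)))) -
        ∑ j, h n j ^ 2 * (T j * biasMoment d L j) := by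
      rw [← Finset.sum_sub_distrib]
      exact Finset.sum_congr rfl fun j _ => by simp only [a]; ring
    rw [e5]
    ring
  · have hsq : Tendsto (fun n => (rho d (h n))⁻¹ *
        ∫ y, L (capVec (h n) x y) ^ 2 * f y ∂(polyMeasure d)) atTop
        (𝓝 (lam d (fun s => L s ^ 2) * f x)) :=
      tendsto_integral_mul hr hd hA1 hA2.hasMoments_sq hpos hlim x
    have hlim0 := (((hinv.pow 2).mul hsq).sub ((tendsto_rho hr hd hlim).mul (hmean.pow 2))).sub_const
      (varMoment d L * f x)
    -- The bracket of `variance_kde` tends to v_d(L) f(x), so the difference is (nρ)⁻¹ times o(1).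
    have e0 : (lam d L)⁻¹ ^ 2 * (lam d (fun s => L s ^ 2) * f x) - 0 * f x ^ 2 -
        varMoment d L * f x = 0 := by
      rw [varMoment]
      field_simp
      ring
    rw [e0] at hlim0
    have h1 := (isBigO_refl (fun n : ℕ => ((n : ℝ) * rho d (h n))⁻¹) atTop).mul_isLittleO
      ((isLittleO_one_iff ℝ).2 hlim0)
    simp only [mul_one] at h1
    refine h1.congr' ?_ EventuallyEq.rfl
    filter_upwards [eventually_ne_atTop 0] with n hn
    rw [variance_kde hd (hpos n) hA2 hf hindep hlaw x j₀ hn]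
    ring
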